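/- Let $f\colon X\to Y$ be a continuous map of simply connected topological spaces. For $i\ge 0$ let $H_i(f;\mathbb Q)\colon H_i(X;\mathbb Q)\to H_i(Y;\mathbb Q)$ be the induced map on rational singular homology, and for $i\ge 2$ let $\pi_i(f)\otimes\mathbb Q\colon \pi_i(X)\otimes\mathbb Q\to\pi_i(Y)\otimes\mathbb Q$ be the induced map on rational homotopy groups (taken at a base point $x\in X$ and at $f(x)$). Call $f$ *rationally elliptic with respect to kernel* if $$\sum_{i\ge 0}\dim\operatorname{Ker}H_i(f;\mathbb Q)<\infty\quad\text{and}\quad \sum_{i\ge 2}\dim\operatorname{Ker}(\pi_i(f)\otimes\mathbb Q)<\infty ,$$ and in that case put $$P_f(t)=1+\sum_{i\ge 2}\dim\bigl(\operatorname{Ker}H_i(f;\mathbb Q)\bigr)\,t^i,\qquad P^{\pi}_f(t)=\sum_{i\ge 2}\dim\bigl(\operatorname{Ker}(\pi_i(f)\otimes\mathbb Q)\bigr)\,t^i .$$ For $n\ge 0$ let $f^n\colon X^n\to Y^n$ be the map $(x_1,\dots,x_n)\mapsto(f(x_1),\dots,f(x_n))$. Suppose that $f$ is rationally elliptic with respect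 to kernel, that $\sum_{i\ge 0}\dim H_i(X;\mathbb Q)<\infty$, and that $P_f(1)>1$. Then every $f^n$ is rationally elliptic with respect to kernel (so that $P_{f^n}$ and $P^{\pi}_{f^n}$ are polynomials), and for every real $s\ge 0$ there is a positive integer $n(s)$ such that $$P^{\pi}_{f^n}(s)<P_{f^n}(s)\qquad\text{for all } n\ge n(s).$$ -/

import Mathlib

open CategoryTheory
open scoped Topology TensorProduct unitInterval

universe u

noncomputable section

namespace RelHilali

variable {X Y : Type u} [TopologicalSpace X] [TopologicalSpace Y]

/-! ### Rational homology -/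

/-- `H_i(X; ℚ)`: singular homology with rational coefficients. -/
abbrev ratHomology (i : ℕ) (X : Type u) [TopologicalSpace X] : ModuleCat.{u} ℚ :=
  ((AlgebraicTopology.singularHomologyFunctor (ModuleCat.{u} ℚ) i).obj
    (ModuleCat.of ℚ (ULift.{u} ℚ))).obj (TopCat.of X)

/-- The `ℚ`-linear map `H_i(f; ℚ) : H_i(X; ℚ) → H_i(Y; ℚ)`. -/
def ratHomologyMap (i : ℕ) (f : C(X, Y)) : ratHomology i X →ₗ[ℚ] ratHomology i Y :=
  (((AlgebraicTopology.singularHomologyFunctor (ModuleCat.{u} ℚ) i).obj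
    (ModuleCat.of ℚ (ULift.{u} ℚ))).map (TopCat.ofHom f)).hom

/-- The homology rank of `X` is finite: `∑ i, dim H_i(X; ℚ) < ∞`, i.e. every `H_i(X; ℚ)` is
finite dimensional and only finitely many of them are nonzero. -/
def HasFiniteHomologyRank (X : Type u) [TopologicalSpace X] : Prop :=
  (∀ i, FiniteDimensional ℚ (ratHomology i X)) ∧ {i | Nontrivial (ratHomology i X)}.Finite

/-! ### Rational homotopy -/

/-- Composition of a generalized loop with a continuous map. -/
def genLoopMap {N : Type} (f : C(X, Y)) (x : X) (p : GenLoop N X x) : GenLoop N Y (f x) :=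
  ⟨f.comp p.1, fun y hy => congrArg f (p.2 y hy)⟩

/-- The map of sets `π_N(X, x) → π_N(Y, f x)` induced by composition with `f`. -/
def homotopyGroupMap {N : Type} (f : C(X, Y)) (x : X) :
    HomotopyGroup N X x → HomotopyGroup N Y (f x) :=
  Quotient.map (genLoopMap f x) fun _ _ h => ContinuousMap.HomotopicRel.comp_continuousMap h f

/-- The group homomorphism `π_i(f) : π_i(X, x) → π_i(Y, f x)` for `i = k + 2 ≥ 2`. -/
def piHom (k : ℕ) (f : C(X, Y)) (x : X) : π_ (k + 2) X x →* π_ (k + 2) Y (f x) :=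
  MonoidHom.mk' (homotopyGroupMap f x) (by
    rintro ⟨p⟩ ⟨q⟩
    have h1 := HomotopyGroup.mul_spec (i := (0 : Fin (k + 2))) (p := p) (q := q)
    have h2 := HomotopyGroup.mul_spec (i := (0 : Fin (k + 2)))
      (p := genLoopMap f x p) (q := genLoopMap f x q)
    refine (congrArg (homotopyGroupMap f x) h1).trans (Eq.trans ?_ h2.symm)
    refine congrArg (Quotient.mk _) ?_
    ext t
    change f (if _ then _ else _) = if _ then _ else _
    rw [apply_ite f]
    rfl)

/-- The `ℚ`-linear map `π_i(f) ⊗ ℚ : π_i(X, x) ⊗ ℚ → π_i(Y, f x) ⊗ ℚ` for `i = k + 2 ≥ 2`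
(the abelian groups `π_i` are written additively for the tensor product over `ℤ`). -/
def ratPiMap (k : ℕ) (f : C(X, Y)) (x : X) :
    ℚ ⊗[ℤ] Additive (π_ (k + 2) X x) →ₗ[ℚ] ℚ ⊗[ℤ] Additive (π_ (k + 2) Y (f x)) :=
  LinearMap.baseChange ℚ (MonoidHom.toAdditive (piHom k f x)).toIntLinearMap

/-! ### Rationally elliptic maps with respect to kernel, and their Poincaré polynomials -/

/-- `f` is rationally elliptic with respect to kernel: `∑ i, dim Ker H_i(f; ℚ) < ∞` and
`∑ i, dim Ker (π_i(f) ⊗ ℚ) < ∞`; each sum of dimensions is finite iff all its terms are finite and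
only finitely many are nonzero. Homotopy groups are taken at `x` and `f x`, in degrees `≥ 2`
(the spaces will be simply connected). -/
structure IsRatEllipticKer (f : C(X, Y)) (x : X) : Prop where
  finite_homology : ∀ i, FiniteDimensional ℚ (LinearMap.ker (ratHomologyMap i f))
  bounded_homology : {i | LinearMap.ker (ratHomologyMap i f) ≠ ⊥}.Finite
  finite_homotopy : ∀ k, FiniteDimensional ℚ (LinearMap.ker (ratPiMap k f x))
  bounded_homotopy : {k | LinearMap.ker (ratPiMap k f x) ≠ ⊥}.Finite

open Polynomial in
/-- The homological Poincaré polynomial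
`P_f(t) = 1 + ∑ i ≥ 2, dim (Ker H_i(f; ℚ)) t ^ i` (with `i = k + 2`). -/
def homPoly (f : C(X, Y)) : ℝ[X] :=
  1 + ∑ᶠ k : ℕ, monomial (k + 2)
    (Module.finrank ℚ (LinearMap.ker (ratHomologyMap (k + 2) f)) : ℝ)

open Polynomial in
/-- The homotopical Poincaré polynomial
`P^π_f(t) = ∑ i ≥ 2, dim (Ker (π_i(f) ⊗ ℚ)) t ^ i` (with `i = k + 2`). -/
def piPoly (f : C(X, Y)) (x : X) : ℝ[X] :=
  ∑ᶠ k : ℕ, monomial (k + 2) (Module.finrank ℚ (LinearMap.ker (ratPiMap k f x)) : ℝ)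

/-- The map `f^n : X^n → Y^n`, `(x_1, …, x_n) ↦ (f x_1, …, f x_n)`. -/
def powMap (f : C(X, Y)) (n : ℕ) : C(Fin n → X, Fin n → Y) :=
  ⟨fun a i => f (a i), by fun_prop⟩

end RelHilali

end

/-! The two polynomials grow at different rates in `n`. Homotopy groups turn powers into direct
sums, so the kernel of `π_i(f^n) ⊗ ℚ` is `n` copies of that of `π_i(f) ⊗ ℚ`, and `P^π_{f^n}(s) = n
P^π_f(s)` (`eval_piPoly_powMap`). In homology, `P_f(1) > 1` provides a class `z ≠ 0` of some degree
`d ≥ 2` with `f_* z = 0`. Placing `z × z` in the coordinates `i` and `j` of `X^n` gives elements of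
`Ker H_{2d}(f^n)`. Both projections `X × X → X` kill `z × z`, so projecting `X^n` to pairs of
coordinates separates these elements. Letting `i` and `j` range over two disjoint sets of `m =
⌊n/2⌋` coordinates gives `P_{f^n}(s) ≥ 1 + m² s^{2d}` (`sq_le_finrank_ker_powMap`). For `s > 0`
quadratic growth beats linear growth; at `s = 0` the claim is `0 < 1`.

What remains is that `X^n` has finite total homology and that the class `z × z` exists with these
properties. Both come from a partial substitute for the Künneth theorem that needs no shuffle maps.
Singular chains on `X × Y` are the levelwise tensor product of simplicial vector spaces. For fixed
`W`, the functor `V ↦ V ⊗ W` is transported along the Dold-Kan equivalence to `tensorComplex W` on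
chain complexes. It is exact since vector spaces are flat. It preserves acyclicity since an acyclic
simplicial vector space is simplicially contractible (`exists_homotopy_zero_id`) and simplicial
homotopies survive levelwise tensoring. Hence it makes disks acyclic, and the sequences `sphere d →
disk d → sphere (d + 1)` show that it sends `sphere d` to a complex whose homology is that of `W`
shifted by `d`.

Over a field, every nonzero homology class splits off a sphere (`exists_sphere_retraction`).
Removing spheres one at a time proves finiteness (`hasFiniteHomology_tensorComplex`). The same
splitting shows that `z × z` is nonzero, while a sphere whose class dies extends over a disk, so its
cross products die too (`exists_cross_class`). -/

noncomputable section

open CategoryTheory Limits Opposite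
open scoped Simplicial

/-! ### Contractions of acyclic complexes of vector spaces -/

namespace ModuleCat

variable {k : Type} [Field k]

/-- Every morphism of vector spaces has a generalized inverse. -/
lemma exists_comp_comp_eq_self {U V : ModuleCat.{u} k} (f : U ⟶ V) :
    ∃ g : V ⟶ U, f ≫ g ≫ f = f := by
  obtain ⟨s, hs⟩ := f.hom.rangeRestrict.exists_rightInverse_of_surjective
    (LinearMap.range_rangeRestrict _)
  obtain ⟨r, hr⟩ := (LinearMap.range f.hom).subtype.exists_leftInverse_of_injective
    (Submodule.ker_subtype _)
  refine ⟨ofHom (s ∘ₗ r), ?_⟩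
  ext x
  have h1 := LinearMap.congr_fun hr (f.hom.rangeRestrict x)
  have h2 := LinearMap.congr_fun hs (f.hom.rangeRestrict x)
  simp only [LinearMap.comp_apply, LinearMap.id_apply] at h1 h2
  have h3 : f.hom (s (r (f.hom x))) = f.hom x := by
    have h4 : r (f.hom x) = f.hom.rangeRestrict x := h1
    rw [h4]
    exact congrArg Subtype.val h2
  exact h3

end ModuleCat

namespace ChainComplex

variable {k : Type} [Field k]

/-- A generalized inverse of `d` is a section of `d` over the boundaries, and by exactness every
cycle is a boundary. -/
lemma comp_eq_self_of_exactAt {C : ChainComplex (ModuleCat.{u} k) ℕ} {i j l : ℕ}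
    (hij : (ComplexShape.down ℕ).Rel i j) (hjl : (ComplexShape.down ℕ).next j = l)
    (h : C.ExactAt j) (g : C.X j ⟶ C.X i) (hg : C.d i j ≫ g ≫ C.d i j = C.d i j)
    {T : ModuleCat.{u} k} (t : T ⟶ C.X j) (ht : t ≫ C.d j l = 0) :
    t ≫ g ≫ C.d i j = t := by
  have hij' : (ComplexShape.down ℕ).prev j = i := (ComplexShape.down ℕ).prev_eq' hij
  rw [C.exactAt_iff' i j l hij' hjl] at h
  rw [ShortComplex.moduleCat_exact_iff] at h
  ext x
  obtain ⟨y, hy⟩ := h (t x) (ConcreteCategory.congr_hom ht x)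
  have := ConcreteCategory.congr_hom hg y
  dsimp at hy this ⊢
  rw [← hy]
  exact this

/-- An acyclic chain complex of vector spaces is contractible. -/
theorem exists_nullHomotopicMap'_eq_id (C : ChainComplex (ModuleCat.{u} k) ℕ)
    (h : ∀ n, C.ExactAt n) :
    ∃ c : ∀ i j, (ComplexShape.down ℕ).Rel j i → (C.X i ⟶ C.X j),
      Homotopy.nullHomotopicMap' c = 𝟙 C := by
  choose G hG using fun i j => ModuleCat.exists_comp_comp_eq_self (C.d j i)
  -- In diagrammatic order, `1 - d ≫ G` lands in the cycles because `d ≫ G ≫ d = d`; there `G` is a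
  -- section of `d`.
  refine ⟨fun i j _ => (𝟙 _ - dNext i (fun a b => G a b)) ≫ G i j, ?_⟩
  ext1 n
  have key : ∀ n, (𝟙 (C.X n) - dNext n (fun a b => G a b)) ≫ G n (n + 1) ≫ C.d (n + 1) n =
      𝟙 (C.X n) - dNext n (fun a b => G a b) := by
    intro n
    cases n with
    | zero =>
      -- Nothing follows degree `0`: `next 0` takes the default value `0`, and the differential from
      -- `0` to `0` vanishes.
      refine comp_eq_self_of_exactAt (l := 0) (by simp) (by simp) (h 0) _ (hG _ _) _ ?_
      rw [C.shape _ _ (by simp), comp_zero]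
    | succ n =>
      refine comp_eq_self_of_exactAt (l := n) (by simp) (by simp) (h _) _ (hG _ _) _ ?_
      rw [dNext_eq _ (i' := n) (by simp), Preadditive.sub_comp, Category.assoc, hG,
        Category.id_comp, sub_self]
  cases n with
  | zero =>
    rw [Homotopy.nullHomotopicMap'_f_of_not_rel_left (k₁ := 1) (k₀ := 0) (by simp)
      (fun l hl => by simp at hl)]
    rw [Category.assoc, key, dNext_eq_zero _ _ (by simp)]
    simp
  | succ n =>
    rw [Homotopy.nullHomotopicMap'_f (k₂ := n + 2) (k₁ := n + 1) (k₀ := n) (by simp) (by simp)]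
    rw [Category.assoc, key, dNext_eq (i := n + 1) _ (i' := n) (by simp)]
    have : C.d (n + 1) n ≫ dNext n (fun a b => G a b) = 0 := by
      cases n with
      | zero => rw [dNext_eq_zero _ _ (by simp), comp_zero]
      | succ n =>
        rw [dNext_eq _ (i' := n) (by simp), C.d_comp_d_assoc, zero_comp]
    rw [Preadditive.sub_comp, Preadditive.comp_sub, reassoc_of% this]
    simp

/-- A degreewise split epimorphism onto an acyclic complex of vector spaces splits. -/
theorem exists_section_of_exact {B C : ChainComplex (ModuleCat.{u} k) ℕ} (p : B ⟶ C) [Epi p]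
    (h : ∀ n, C.ExactAt n) : ∃ s : C ⟶ B, s ≫ p = 𝟙 C := by
  obtain ⟨c, hc⟩ := exists_nullHomotopicMap'_eq_id C h
  have hτ : ∀ n, ∃ τ : C.X n ⟶ B.X n, τ ≫ p.f n = 𝟙 _ := fun n => by
    obtain ⟨g, hg⟩ := ModuleCat.exists_comp_comp_eq_self (p.f n)
    exact ⟨g, by rw [← cancel_epi (p.f n), hg, Category.comp_id]⟩
  choose τ hτ using hτ
  -- The degreewise sections `τ` need not commute with `d`. Inserting them into the contraction
  -- gives a chain map anyway, and composing it with `p` recovers the contraction, that is, the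
  -- identity.
  refine ⟨Homotopy.nullHomotopicMap' (fun i j hij => c i j hij ≫ τ j), ?_⟩
  rw [Homotopy.nullHomotopicMap'_comp]
  simp only [Category.assoc, hτ, Category.comp_id]
  exact hc

end ChainComplex

end

noncomputable section

open CategoryTheory Limits Opposite AlgebraicTopology
open scoped Simplicial ZeroObject

/-! ### Décalage -/

namespace SimplexCategory

/-- The functor `⦋n⦌ ↦ ⦋n + 1⦌` adding a new smallest vertex. -/
def cone : SimplexCategory ⥤ SimplexCategory where
  obj a := ⦋a.len + 1⦌
  map {a b} f := Hom.mk
    { toFun := Fin.cases 0 (fun i => (f.toOrderHom i).succ)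
      monotone' := by
        intro i j hij
        cases i using Fin.cases with
        | zero => exact Fin.zero_le _
        | succ i =>
          cases j using Fin.cases with
          | zero => exact absurd hij (by simp)
          | succ j => exact Fin.succ_le_succ_iff.2 (f.toOrderHom.monotone
              (Fin.succ_le_succ_iff.1 hij)) }
  map_id a := by
    ext i : 3
    cases i using Fin.cases <;> rfl
  map_comp f g := by
    ext i : 3
    cases i using Fin.cases <;> rfl

lemma cone_map_δ {n : ℕ} (i : Fin (n + 2)) :
    cone.map (SimplexCategory.δ i) = SimplexCategory.δ i.succ := by
  ext j : 3
  cases j using Fin.cases with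
  | zero => exact (Fin.succ_succAbove_zero i).symm
  | succ j => exact (Fin.succ_succAbove_succ i j).symm

lemma cone_map_σ {n : ℕ} (i : Fin (n + 1)) :
    cone.map (SimplexCategory.σ i) = SimplexCategory.σ i.succ := by
  ext j : 3
  cases j using Fin.cases with
  | zero => exact (Fin.predAbove_right_zero (i := i.succ)).symm
  | succ j => exact (Fin.succ_predAbove_succ i j).symm

/-- The inclusion of the face opposite to the new vertex. -/
def toCone : 𝟭 SimplexCategory ⟶ cone where
  app a := δ (n := a.len) 0
  naturality a b f := by
    ext i : 3
    rfl

end SimplexCategory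

namespace CategoryTheory.SimplicialObject

variable {C : Type*} [Category* C]

/-- The décalage of a simplicial object. -/
def dec (V : SimplicialObject C) : SimplicialObject C := SimplexCategory.cone.op ⋙ V

/-- The face map `d₀`, as a morphism from the décalage. -/
def decFace (V : SimplicialObject C) : V.dec ⟶ V where
  app a := V.map (SimplexCategory.toCone.app a.unop).op
  naturality a b f := by
    have := congrArg Quiver.Hom.op (SimplexCategory.toCone.naturality f.unop)
    exact (V.map_comp _ _).symm.trans ((congrArg V.map this.symm).trans (V.map_comp _ _))

lemma dec_δ (V : SimplicialObject C) {n : ℕ} (i : Fin (n + 2)) :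
    V.dec.δ i = V.δ i.succ :=
  congrArg (fun f : ⦋n + 1⦌ ⟶ ⦋n + 2⦌ => V.map f.op) (SimplexCategory.cone_map_δ i)

lemma dec_σ (V : SimplicialObject C) {n : ℕ} (i : Fin (n + 1)) :
    V.dec.σ i = V.σ i.succ :=
  congrArg (fun f : ⦋n + 2⦌ ⟶ ⦋n + 1⦌ => V.map f.op) (SimplexCategory.cone_map_σ i)

/-- The structure maps of the décalage omit `V.δ 0` and `V.σ 0`. The first is the map to `V`; the
second splits it levelwise, though not simplicially. -/
instance [Balanced C] (V : SimplicialObject C) : Epi V.decFace := by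
  have : ∀ a, Epi (V.decFace.app a) := fun a => by
    have : V.σ (n := a.unop.len) 0 ≫ V.decFace.app a = 𝟙 _ := V.δ_comp_σ_self (i := 0)
    exact (SplitEpi.mk _ this).epi
  exact NatTrans.epi_of_epi_app _

end CategoryTheory.SimplicialObject

/-! ### Simplicial contraction of acyclic simplicial vector spaces -/

namespace AlgebraicTopology.DoldKan

variable {k : Type} [Field k]

open CategoryTheory.SimplicialObject

/-- The homology of the normalized and of the alternating complex agree. -/
def homologyNormalizedIso (V : SimplicialObject (ModuleCat.{u} k)) (n : ℕ) :
    ((normalizedMooreComplex _).obj V).homology n ≅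
      ((alternatingFaceMapComplex _).obj V).homology n :=
  (homotopyEquivNormalizedMooreComplexAlternatingFaceMapComplex).toHomologyIso n

/-- A simplicial vector space whose normalized complex is acyclic is contractible. -/
theorem exists_homotopy_zero_id (V : SimplicialObject (ModuleCat.{u} k))
    (hV : ∀ n, ((normalizedMooreComplex _).obj V).ExactAt n) :
    Nonempty (SimplicialObject.Homotopy (0 : V ⟶ V) (𝟙 V)) := by
  have : Epi ((normalizedMooreComplex _).map V.decFace) :=
    inferInstanceAs (Epi (CategoryTheory.Abelian.DoldKan.equivalence.functor.map V.decFace))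
  obtain ⟨s', hs'⟩ := ChainComplex.exists_section_of_exact
    ((normalizedMooreComplex _).map V.decFace) hV
  -- The normalized complex functor is fully faithful, so the section found on complexes is
  -- simplicial.
  obtain ⟨s, hs⟩ : ∃ s : V ⟶ V.dec, s ≫ V.decFace = 𝟙 V := by
    let F := (CategoryTheory.Abelian.DoldKan.equivalence (A := ModuleCat.{u} k)).functor
    obtain ⟨s, hs⟩ := F.map_surjective (X := V) (Y := V.dec) s'
    refine ⟨s, F.map_injective ?_⟩
    rw [F.map_comp, hs, F.map_id]
    exact hs'
  have hepi : Epi (((alternatingFaceMapComplex _).obj V).d 1 0) := by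
    have h0 : IsZero (((alternatingFaceMapComplex _).obj V).homology 0) :=
      ((hV 0).isZero_homology).of_iso (homologyNormalizedIso V 0).symm
    rw [← HomologicalComplex.exactAt_iff_isZero_homology,
      HomologicalComplex.exactAt_iff' _ 1 0 0 (by simp) (by simp)] at h0
    exact (ShortComplex.exact_iff_epi _ (((alternatingFaceMapComplex _).obj V).shape 0 0 (by simp))).1 h0
  -- Unwound levelwise, a section of `decFace` satisfies the identities of an extra degeneracy,
  -- apart from the condition on `t 0 ≫ V.δ 1`.
  obtain ⟨t, ht, htδ, htσ⟩ : ∃ t : ∀ n, V _⦋n⦌ ⟶ V _⦋n + 1⦌,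
      (∀ n, t n ≫ V.δ 0 = 𝟙 _) ∧
      (∀ n (i : Fin (n + 2)), t (n + 1) ≫ V.δ i.succ = V.δ i ≫ t n) ∧
      ∀ n (i : Fin (n + 1)), t n ≫ V.σ i.succ = V.σ i ≫ t (n + 1) := by
    refine ⟨fun n => s.app (op ⦋n⦌), fun n => NatTrans.congr_app hs (op ⦋n⦌), fun n i => ?_,
      fun n i => ?_⟩
    · have := s.naturality (SimplexCategory.δ i).op
      exact (congrArg (s.app _ ≫ ·) (V.dec_δ i).symm).trans this.symm
    · have := s.naturality (SimplexCategory.σ i).op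
      exact (congrArg (s.app _ ≫ ·) (V.dec_σ i).symm).trans this.symm
  -- As `H_0` vanishes, `δ 0 - δ 1` is epi and the identity may be tested after it, where it reduces
  -- to `δ 2 ≫ δ 1 = δ 1 ≫ δ 1`.
  have ht0 : t 0 ≫ V.δ 1 = 0 := by
    rw [← cancel_epi (((alternatingFaceMapComplex _).obj V).d 1 0)]
    have h0 : V.δ 0 ≫ t 0 = t 1 ≫ V.δ 1 := (htδ 0 0).symm
    have h1 : V.δ 1 ≫ t 0 = t 1 ≫ V.δ 2 := (htδ 0 1).symm
    have h2 : V.δ 2 ≫ V.δ 1 = V.δ 1 ≫ V.δ 1 := V.δ_comp_δ (n := 0) (i := 1) (j := 1) le_rfl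
    have h3 : ((alternatingFaceMapComplex _).obj V).d 1 0 = V.δ 0 - V.δ 1 := by
      rw [alternatingFaceMapComplex_obj_d]
      simp [AlternatingFaceMapComplex.objD, Fin.sum_univ_two, sub_eq_add_neg]
    rw [h3, Preadditive.sub_comp, reassoc_of% h0, reassoc_of% h1, comp_zero, h2, sub_self]
  let A : SimplicialObject.Augmented (ModuleCat.{u} k) :=
    { left := V
      right := 0
      hom := 0 }
  let e : A.ExtraDegeneracy :=
    { s' := 0
      s := t
      s'_comp_ε := (isZero_zero (ModuleCat.{u} k)).eq_of_src _ _
      s₀_comp_δ₁ := by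
        rw [comp_zero]
        exact ht0
      s_comp_δ₀ := ht
      s_comp_δ := htδ
      s_comp_σ := htσ }
  -- The augmentation is to `0`, so the retraction onto it is the zero map.
  have H := e.homotopy
  have : A.hom ≫ e.section_ = 0 := zero_comp
  rw [this] at H
  exact ⟨H⟩

end AlgebraicTopology.DoldKan

end

noncomputable section

open CategoryTheory Limits Opposite AlgebraicTopology
open scoped Simplicial ZeroObject

/-! ### Tensor products of simplicial vector spaces -/

namespace ModuleCat

variable {k : Type} [Field k]

/-- Tensoring with a fixed vector space, in the universe of the vector spaces. -/
def rTensorFunctor (W : ModuleCat.{u} k) : ModuleCat.{u} k ⥤ ModuleCat.{u} k where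
  obj V := of k (V ⊗[k] W)
  map f := ofHom (f.hom.rTensor W)
  map_id V := by ext : 1; exact LinearMap.rTensor_id W V
  map_comp f g := by ext : 1; exact LinearMap.rTensor_comp W g.hom f.hom

instance (W : ModuleCat.{u} k) : (rTensorFunctor W).Additive where
  map_add {_ _ f g} := by ext : 1; exact LinearMap.rTensor_add W f.hom g.hom

/-- Tensoring with a vector space is exact. -/
lemma shortExact_map_rTensorFunctor (W : ModuleCat.{u} k) {S : ShortComplex (ModuleCat.{u} k)}
    (hS : S.ShortExact) : (S.map (rTensorFunctor W)).ShortExact := by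
  have hf := (ModuleCat.mono_iff_injective _).1 hS.mono_f
  have hg := (ModuleCat.epi_iff_surjective _).1 hS.epi_g
  have h := (ShortComplex.ShortExact.moduleCat_exact_iff_function_exact _).1 hS.exact
  refine ShortComplex.ShortExact.mk' ?_ ?_ ?_
  · rw [ShortComplex.ShortExact.moduleCat_exact_iff_function_exact]
    exact rTensor_exact W h hg
  · exact (ModuleCat.mono_iff_injective _).2
      (Module.Flat.rTensor_preserves_injective_linearMap S.f.hom hf)
  · exact (ModuleCat.epi_iff_surjective _).2 (LinearMap.rTensor_surjective W hg)

end ModuleCat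

namespace CategoryTheory.SimplicialObject

variable {k : Type} [Field k]

/-- The levelwise tensor product of simplicial vector spaces. -/
def tensor (V W : SimplicialObject (ModuleCat.{u} k)) : SimplicialObject (ModuleCat.{u} k) where
  obj a := ModuleCat.of k (V.obj a ⊗[k] W.obj a)
  map f := ModuleCat.ofHom (TensorProduct.map (V.map f).hom (W.map f).hom)
  map_id a := by
    ext : 1
    dsimp
    rw [V.map_id, W.map_id]
    exact TensorProduct.map_id
  map_comp f g := by
    ext : 1
    dsimp
    rw [V.map_comp, W.map_comp]
    exact TensorProduct.map_comp _ _ _ _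

/-- The levelwise tensor product of morphisms. -/
def tensorMap {V V' W W' : SimplicialObject (ModuleCat.{u} k)} (f : V ⟶ V') (g : W ⟶ W') :
    tensor V W ⟶ tensor V' W' where
  app a := ModuleCat.ofHom (TensorProduct.map (f.app a).hom (g.app a).hom)
  naturality a b h := by
    ext : 1
    dsimp [tensor]
    rw [← TensorProduct.map_comp, ← TensorProduct.map_comp, ← ModuleCat.hom_comp,
      ← ModuleCat.hom_comp, f.naturality, g.naturality]
    rfl

lemma tensorMap_id (V W : SimplicialObject (ModuleCat.{u} k)) :
    tensorMap (𝟙 V) (𝟙 W) = 𝟙 (tensor V W) := by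
  ext a : 2
  exact TensorProduct.map_id

lemma tensorMap_comp {V V' V'' W W' W'' : SimplicialObject (ModuleCat.{u} k)} (f : V ⟶ V')
    (f' : V' ⟶ V'') (g : W ⟶ W') (g' : W' ⟶ W'') :
    tensorMap (f ≫ f') (g ≫ g') = tensorMap f g ≫ tensorMap f' g' := by
  ext a : 2
  exact TensorProduct.map_comp _ _ _ _

lemma tensorMap_zero {V V' W W' : SimplicialObject (ModuleCat.{u} k)} (g : W ⟶ W') :
    tensorMap (0 : V ⟶ V') g = 0 := by
  ext a : 2
  exact TensorProduct.map_zero_left _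

/-- Tensoring with a fixed simplicial vector space. -/
def tensorFunctor (W : SimplicialObject (ModuleCat.{u} k)) :
    SimplicialObject (ModuleCat.{u} k) ⥤ SimplicialObject (ModuleCat.{u} k) where
  obj V := tensor V W
  map f := tensorMap f (𝟙 W)
  map_id V := tensorMap_id V W
  map_comp f g := by rw [← tensorMap_comp, Category.comp_id]

/-- Simplicial homotopies are preserved by tensoring with a simplicial vector space. -/
def Homotopy.tensorRight {V V' : SimplicialObject (ModuleCat.{u} k)} {f g : V ⟶ V'}
    (H : Homotopy f g) (W : SimplicialObject (ModuleCat.{u} k)) :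
    Homotopy (tensorMap f (𝟙 W)) (tensorMap g (𝟙 W)) :=
  have key {A B C A' B' C' : ModuleCat.{u} k} {B₁ B₁' : ModuleCat.{u} k} {p : A ⟶ B} {q : B ⟶ C}
      {p₁ : A ⟶ B₁} {q₁ : B₁ ⟶ C}
      {p' : A' ⟶ B'} {q' : B' ⟶ C'} {p₁' : A' ⟶ B₁'} {q₁' : B₁' ⟶ C'} (h : p ≫ q = p₁ ≫ q₁)
      (h' : p' ≫ q' = p₁' ≫ q₁') :
      ModuleCat.ofHom (TensorProduct.map p.hom p'.hom) ≫
        ModuleCat.ofHom (TensorProduct.map q.hom q'.hom) =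
      ModuleCat.ofHom (TensorProduct.map p₁.hom p₁'.hom) ≫
        ModuleCat.ofHom (TensorProduct.map q₁.hom q₁'.hom) := by
    ext : 1
    dsimp
    rw [← TensorProduct.map_comp, ← TensorProduct.map_comp, ← ModuleCat.hom_comp,
      ← ModuleCat.hom_comp, ← ModuleCat.hom_comp, ← ModuleCat.hom_comp, h, h']
  have key' {A B C A' B' C' : ModuleCat.{u} k} {p : A ⟶ B} {q : B ⟶ C} {r : A ⟶ C}
      {p' : A' ⟶ B'} {q' : B' ⟶ C'} {r' : A' ⟶ C'} (h : p ≫ q = r) (h' : p' ≫ q' = r') :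
      ModuleCat.ofHom (TensorProduct.map p.hom p'.hom) ≫
        ModuleCat.ofHom (TensorProduct.map q.hom q'.hom) =
      ModuleCat.ofHom (TensorProduct.map r.hom r'.hom) := by
    ext : 1
    dsimp
    rw [← TensorProduct.map_comp, ← ModuleCat.hom_comp, ← ModuleCat.hom_comp, h, h']
  -- The homotopy on `V` is paired with the constant homotopy on `W`, whose components are the
  -- degeneracies.
  { h := fun i => ModuleCat.ofHom (TensorProduct.map (H.h i).hom (W.σ i).hom)
    h_zero_comp_δ_zero := fun n => key' (H.h_zero_comp_δ_zero n) (W.δ_comp_σ_self (i := 0))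
    h_last_comp_δ_last := fun n =>
      key' (H.h_last_comp_δ_last n) (W.δ_comp_σ_succ (i := Fin.last n))
    h_succ_comp_δ_castSucc_of_lt := fun i j hij =>
      key (H.h_succ_comp_δ_castSucc_of_lt i j hij) (W.δ_comp_σ_of_le hij)
    h_succ_comp_δ_castSucc_succ := fun j =>
      key (H.h_succ_comp_δ_castSucc_succ j)
        ((W.δ_comp_σ_self (i := j.succ)).trans (W.δ_comp_σ_succ (i := j.castSucc)).symm)
    h_castSucc_comp_δ_succ_of_lt := fun i j hij =>
      key (H.h_castSucc_comp_δ_succ_of_lt i j hij) (W.δ_comp_σ_of_gt hij)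
    h_comp_σ_castSucc_of_le := fun i j hij =>
      key (H.h_comp_σ_castSucc_of_le i j hij) (W.σ_comp_σ hij)
    h_comp_σ_succ_of_lt := fun i j hij =>
      key (H.h_comp_σ_succ_of_lt i j hij) (W.σ_comp_σ hij).symm }

end CategoryTheory.SimplicialObject

namespace AlgebraicTopology.DoldKan

variable {k : Type} [Field k]

open CategoryTheory.SimplicialObject

/-- Tensoring an acyclic simplicial vector space with any other one gives an acyclic one. -/
theorem exactAt_tensor (V W : SimplicialObject (ModuleCat.{u} k))
    (hV : ∀ n, ((normalizedMooreComplex _).obj V).ExactAt n) (n : ℕ) :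
    ((alternatingFaceMapComplex _).obj (tensor V W)).ExactAt n := by
  obtain ⟨H⟩ := exists_homotopy_zero_id V hV
  have h := (H.tensorRight W).map_homology_eq n
  rw [tensorMap_zero, tensorMap_id, Functor.map_zero, Functor.map_zero, CategoryTheory.Functor.map_id,
    CategoryTheory.Functor.map_id] at h
  rw [HomologicalComplex.exactAt_iff_isZero_homology]
  exact (IsZero.iff_id_eq_zero _).2 h.symm

/-- The functor on chain complexes which corresponds under the Dold-Kan equivalence to tensoring
with a simplicial vector space. -/
def tensorComplex (W : SimplicialObject (ModuleCat.{u} k)) :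
    ChainComplex (ModuleCat.{u} k) ℕ ⥤ ChainComplex (ModuleCat.{u} k) ℕ :=
  CategoryTheory.Abelian.DoldKan.equivalence.inverse ⋙ tensorFunctor W ⋙
    alternatingFaceMapComplex _

/-- The naturality of `tensorComplex` in the simplicial vector space. -/
def tensorComplexMap {W W' : SimplicialObject (ModuleCat.{u} k)} (g : W ⟶ W') :
    tensorComplex W ⟶ tensorComplex W' where
  app C := (alternatingFaceMapComplex _).map (tensorMap (𝟙 _) g)
  naturality C C' f := by
    let φ := CategoryTheory.Abelian.DoldKan.equivalence.inverse.map f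
    have h : tensorMap φ (𝟙 W) ≫ tensorMap (𝟙 _) g = tensorMap (𝟙 _) g ≫ tensorMap φ (𝟙 W') := by
      rw [← tensorMap_comp, ← tensorMap_comp]
      simp only [Category.comp_id, Category.id_comp]
    exact ((alternatingFaceMapComplex _).map_comp _ _).symm.trans
      ((congrArg (alternatingFaceMapComplex _).map h).trans
        ((alternatingFaceMapComplex _).map_comp _ _))

instance (W : SimplicialObject (ModuleCat.{u} k)) : (tensorComplex W).PreservesZeroMorphisms where
  map_zero C C' := by
    have h : tensorMap (CategoryTheory.Abelian.DoldKan.equivalence.inverse.map (0 : C ⟶ C'))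
        (𝟙 W) = 0 := by
      rw [Functor.map_zero, tensorMap_zero]
    exact (congrArg (alternatingFaceMapComplex _).map h).trans (Functor.map_zero _ _ _)

theorem tensorComplex_exactAt (W : SimplicialObject (ModuleCat.{u} k))
    {C : ChainComplex (ModuleCat.{u} k) ℕ} (hC : ∀ n, C.ExactAt n) (n : ℕ) :
    ((tensorComplex W).obj C).ExactAt n :=
  exactAt_tensor _ W (fun n => (hC n).of_iso
    (CategoryTheory.Abelian.DoldKan.equivalence.counitIso.app C).symm) n

/-- Exactness is checked degreewise: the inverse Dold-Kan functor and evaluation are exact, and in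
each degree one tensors with a fixed vector space. -/
theorem shortExact_map_tensorComplex (W : SimplicialObject (ModuleCat.{u} k))
    {S : ShortComplex (ChainComplex (ModuleCat.{u} k) ℕ)} (hS : S.ShortExact) :
    (S.map (tensorComplex W)).ShortExact := by
  refine HomologicalComplex.shortExact_of_degreewise_shortExact _ fun n => ?_
  have h1 := hS.map_of_exact (CategoryTheory.Abelian.DoldKan.equivalence.inverse ⋙
    (evaluation _ _).obj (op ⦋n⦌))
  exact ModuleCat.shortExact_map_rTensorFunctor (W.obj (op ⦋n⦌)) h1

/-- `tensorComplex` computes the complex of a tensor product. -/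
def tensorComplexIso (V W : SimplicialObject (ModuleCat.{u} k)) :
    (tensorComplex W).obj ((normalizedMooreComplex _).obj V) ≅
      (alternatingFaceMapComplex _).obj (tensor V W) :=
  (tensorFunctor W ⋙ alternatingFaceMapComplex _).mapIso
    (CategoryTheory.Abelian.DoldKan.equivalence.unitIso.app V).symm

end AlgebraicTopology.DoldKan

end

noncomputable section

open CategoryTheory Limits Opposite AlgebraicTopology
open scoped Simplicial ZeroObject

/-! ### Spheres and disks as chain complexes -/

namespace ModuleCat

variable (k : Type) [Field k]

/-- The ground field, in the universe of the vector spaces. -/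
abbrev unit : ModuleCat.{u} k := of k (ULift.{u} k)

variable {k}

/-- The linear map from the ground field with a given value at `1`. -/
def ofElement {A : ModuleCat.{u} k} (x : A) : unit k ⟶ A :=
  ofHom (LinearMap.toSpanSingleton k A x ∘ₗ ULift.moduleEquiv.toLinearMap)

lemma ofElement_apply_one {A : ModuleCat.{u} k} (x : A) :
    (ofElement x).hom (ULift.up 1) = x := one_smul k x

lemma unit_hom_ext {A : ModuleCat.{u} k} {f g : unit k ⟶ A}
    (h : f.hom (ULift.up 1) = g.hom (ULift.up 1)) : f = g := by
  ext ⟨x⟩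
  have hx : (ULift.up x : ULift.{u} k) = x • ULift.up 1 := by
    ext; simp
  change f.hom (ULift.up x) = g.hom (ULift.up x)
  rw [hx, map_smul, map_smul, h]

lemma ofElement_comp {A B : ModuleCat.{u} k} (x : A) (f : A ⟶ B) :
    ofElement x ≫ f = ofElement (f.hom x) :=
  unit_hom_ext <| by
    rw [ofElement_apply_one, hom_comp, LinearMap.comp_apply, ofElement_apply_one]

end ModuleCat

namespace ChainComplex

variable (k : Type) [Field k]

/-- The complex with the ground field in degree `d`. -/
abbrev sphere (d : ℕ) : ChainComplex (ModuleCat.{u} k) ℕ :=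
  (HomologicalComplex.single _ _ d).obj (ModuleCat.unit k)

/-- The acyclic complex with the ground field in degrees `d + 1` and `d`. -/
abbrev disk (d : ℕ) : ChainComplex (ModuleCat.{u} k) ℕ :=
  HomologicalComplex.double (𝟙 (ModuleCat.unit k))
    (show (ComplexShape.down ℕ).Rel (d + 1) d from rfl)

lemma disk_d_of_ne_left (d a b : ℕ) (h : a ≠ d + 1) : (disk.{u} k d).d a b = 0 :=
  HomologicalComplex.double_d_eq_zero₀ _ _ _ _ h

lemma disk_d_of_ne_right (d a b : ℕ) (h : b ≠ d) : (disk.{u} k d).d a b = 0 :=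
  HomologicalComplex.double_d_eq_zero₁ _ _ _ _ h

/-- The inclusion of the boundary of a disk. -/
def sphereToDisk (d : ℕ) : sphere k d ⟶ disk.{u} k d :=
  HomologicalComplex.mkHomFromSingle
    (HomologicalComplex.doubleXIso₁ _ _ (by simp)).inv
    (fun j _ => by
      rw [disk_d_of_ne_left k _ _ _ (Nat.succ_ne_self d).symm, comp_zero])

/-- The collapse of the boundary of a disk. -/
def diskToSphere (d : ℕ) : disk.{u} k d ⟶ sphere k (d + 1) :=
  HomologicalComplex.mkHomToSingle
    (HomologicalComplex.doubleXIso₀ _ _).hom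
    (fun i _ => by
      rw [disk_d_of_ne_right k _ _ _ (Nat.succ_ne_self d), zero_comp])

/-- The short exact sequence relating consecutive spheres. -/
def diskSequence (d : ℕ) : ShortComplex (ChainComplex (ModuleCat.{u} k) ℕ) where
  f := sphereToDisk k d
  g := diskToSphere k d
  zero := by
    apply HomologicalComplex.from_single_hom_ext
    exact (HomologicalComplex.isZero_single_obj_X _ _ _ _ (by simp)).eq_of_tgt _ _

theorem diskSequence_shortExact (d : ℕ) : (diskSequence.{u} k d).ShortExact := by
  refine HomologicalComplex.shortExact_of_degreewise_shortExact _ fun n => ?_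
  by_cases h0 : n = d
  · subst h0
    have h3 : IsZero ((sphere.{u} k (n + 1)).X n) :=
      HomologicalComplex.isZero_single_obj_X _ _ _ _ (by simp)
    have : IsIso ((sphereToDisk.{u} k n).f n) := by
      rw [sphereToDisk, HomologicalComplex.mkHomFromSingle_f]
      infer_instance
    obtain ⟨r, hr, hr'⟩ := this
    exact (ShortComplex.Splitting.mk (S := (diskSequence.{u} k n).map
      (HomologicalComplex.eval _ _ n)) r 0 hr (h3.eq_of_src _ _) (by
        rw [comp_zero, add_zero]
        exact hr')).shortExact
  by_cases h1 : n = d + 1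
  · subst h1
    have h3 : IsZero ((sphere.{u} k d).X (d + 1)) :=
      HomologicalComplex.isZero_single_obj_X _ _ _ _ (by simp)
    have : IsIso ((diskToSphere.{u} k d).f (d + 1)) := by
      rw [diskToSphere, HomologicalComplex.mkHomToSingle_f]
      infer_instance
    obtain ⟨r, hr, hr'⟩ := this
    exact (ShortComplex.Splitting.mk (S := (diskSequence.{u} k d).map
      (HomologicalComplex.eval _ _ (d + 1))) 0 r (h3.eq_of_src _ _) hr' (by
        rw [zero_comp, zero_add]
        exact hr)).shortExact
  · have h : IsZero ((disk.{u} k d).X n) := HomologicalComplex.isZero_double_X _ _ _ h1 h0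
    exact (ShortComplex.Splitting.mk (S := (diskSequence.{u} k d).map
      (HomologicalComplex.eval _ _ n)) 0 0
      ((HomologicalComplex.isZero_single_obj_X (.down ℕ) _ _ _ h0).eq_of_src _ _)
      ((HomologicalComplex.isZero_single_obj_X (.down ℕ) _ _ _ h1).eq_of_src _ _)
      (h.eq_of_src _ _)).shortExact

theorem disk_exactAt (d n : ℕ) : (disk.{u} k d).ExactAt n := by
  have hd : (d + 1) ≠ d := Nat.succ_ne_self d
  by_cases h0 : n = d
  · subst h0
    rw [HomologicalComplex.exactAt_iff' _ (n + 1) n ((ComplexShape.down ℕ).next n) (by simp) rfl,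
      ShortComplex.exact_iff_epi _ (disk_d_of_ne_left k n _ _ hd.symm)]
    change Epi ((disk.{u} k n).d (n + 1) n)
    rw [HomologicalComplex.double_d _ _ hd]
    infer_instance
  by_cases h1 : n = d + 1
  · subst h1
    rw [HomologicalComplex.exactAt_iff' _ (d + 2) (d + 1) d (by simp) (by simp),
      ShortComplex.exact_iff_mono _ (disk_d_of_ne_right k d _ _ hd)]
    change Mono ((disk.{u} k d).d (d + 1) d)
    rw [HomologicalComplex.double_d _ _ hd]
    infer_instance
  · exact ShortComplex.exact_of_isZero_X₂ _
      (HomologicalComplex.isZero_double_X (𝟙 (ModuleCat.unit k)) (show (ComplexShape.down ℕ).Rel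
        (d + 1) d from rfl) _ h1 h0)

variable {k}

/-- The generator of the homology of a sphere. -/
def sphereGen (d : ℕ) : (sphere.{u} k d).homology d :=
  (HomologicalComplex.singleObjHomologySelfIso _ d (ModuleCat.unit k)).inv.hom (ULift.up 1)

/-- The value of a morphism from a sphere at the generator. -/
def sphereEval {d : ℕ} {C : ChainComplex (ModuleCat.{u} k) ℕ} (φ : sphere k d ⟶ C) : C.X d :=
  (φ.f d).hom ((HomologicalComplex.singleObjXSelf _ d (ModuleCat.unit k)).inv.hom (ULift.up 1))

/-- This converts between the two descriptions of a morphism from a sphere: a cycle of `C`, and the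
class that it induces in homology. -/
lemma exists_cycle_sphereEval {d : ℕ} {C : ChainComplex (ModuleCat.{u} k) ℕ}
    (φ : sphere k d ⟶ C) : ∃ y : C.cycles d, (C.iCycles d).hom y = sphereEval φ ∧
      (C.homologyπ d).hom y = (HomologicalComplex.homologyMap φ d).hom (sphereGen d) := by
  let w : (sphere.{u} k d).cycles d :=
    (HomologicalComplex.singleObjCyclesSelfIso _ d (ModuleCat.unit k)).inv.hom (ULift.up 1)
  refine ⟨(HomologicalComplex.cyclesMap φ d).hom w, ?_, ?_⟩
  · have := ConcreteCategory.congr_hom (HomologicalComplex.cyclesMap_i φ d) w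
    refine this.trans ?_
    have := ConcreteCategory.congr_hom (HomologicalComplex.singleObjCyclesSelfIso_inv_iCycles
      (ComplexShape.down ℕ) d (ModuleCat.unit.{u} k)) (ULift.up 1)
    exact congrArg (φ.f d).hom this
  · have := ConcreteCategory.congr_hom (HomologicalComplex.homologyπ_naturality φ d) w
    refine this.symm.trans ?_
    have := ConcreteCategory.congr_hom (HomologicalComplex.singleObjCyclesSelfIso_inv_homologyπ
      (ComplexShape.down ℕ) d (ModuleCat.unit.{u} k)) (ULift.up 1)
    exact congrArg (HomologicalComplex.homologyMap φ d).hom this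

lemma exists_d_eq_of_homologyπ_eq_zero {C : ChainComplex (ModuleCat.{u} k) ℕ} {d : ℕ}
    (y : C.cycles d) (hy : (C.homologyπ d).hom y = 0) :
    ∃ x : C.X (d + 1), (C.d (d + 1) d).hom x = (C.iCycles d).hom y := by
  have h := ShortComplex.exact_of_g_is_cokernel
    (ShortComplex.mk (C.toCycles (d + 1) d) (C.homologyπ d) (by simp))
    (C.homologyIsCokernel (d + 1) d (by simp))
  rw [ShortComplex.moduleCat_exact_iff] at h
  obtain ⟨x, hx⟩ := h y hy
  refine ⟨x, ?_⟩
  have h1 := ConcreteCategory.congr_hom (C.toCycles_i (d + 1) d) x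
  exact h1.symm.trans (congrArg (C.iCycles d).hom hx)

/-- Every homology class is represented by a morphism from a sphere. -/
theorem exists_sphere_hom {C : ChainComplex (ModuleCat.{u} k) ℕ} {d : ℕ} (z : C.homology d) :
    ∃ φ : sphere k d ⟶ C, (HomologicalComplex.homologyMap φ d).hom (sphereGen d) = z := by
  obtain ⟨y, rfl⟩ := (ModuleCat.epi_iff_surjective (C.homologyπ d)).1 inferInstance z
  let φ : sphere k d ⟶ C := HomologicalComplex.mkHomFromSingle
    (ModuleCat.ofElement ((C.iCycles d).hom y)) (fun j _ => by
      rw [ModuleCat.ofElement_comp]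
      have := ConcreteCategory.congr_hom (C.iCycles_d d j) y
      exact (congrArg ModuleCat.ofElement this).trans
        (ModuleCat.unit_hom_ext (ModuleCat.ofElement_apply_one _)))
  refine ⟨φ, ?_⟩
  obtain ⟨y', h1, h2⟩ := exists_cycle_sphereEval φ
  rw [← h2]
  have h3 : sphereEval φ = (C.iCycles d).hom y := by
    simp only [sphereEval, φ, HomologicalComplex.mkHomFromSingle_f]
    have := ConcreteCategory.congr_hom (HomologicalComplex.singleObjXSelf (ComplexShape.down ℕ) d
      (ModuleCat.unit.{u} k)).inv_hom_id (ULift.up 1)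
    exact (congrArg (ModuleCat.ofElement _).hom this).trans (ModuleCat.ofElement_apply_one _)
  rw [h3] at h1
  rw [(ModuleCat.mono_iff_injective (C.iCycles d)).1 inferInstance h1]

/-- A morphism from a sphere which vanishes in homology extends to the disk. -/
theorem exists_disk_factorization {C : ChainComplex (ModuleCat.{u} k) ℕ} {d : ℕ}
    (φ : sphere k d ⟶ C) (h : (HomologicalComplex.homologyMap φ d).hom (sphereGen d) = 0) :
    ∃ ψ : disk k d ⟶ C, sphereToDisk k d ≫ ψ = φ := by
  obtain ⟨y, h1, h2⟩ := exists_cycle_sphereEval φ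
  obtain ⟨x, hx⟩ := exists_d_eq_of_homologyπ_eq_zero y (h2.trans h)
  refine ⟨HomologicalComplex.mkHomFromDouble _ (by simp) (ModuleCat.ofElement x)
    (ModuleCat.ofElement x ≫ C.d (d + 1) d) (by rw [Category.id_comp]) (by simp), ?_⟩
  apply HomologicalComplex.from_single_hom_ext
  rw [HomologicalComplex.comp_f, HomologicalComplex.mkHomFromDouble_f₁, sphereToDisk,
    HomologicalComplex.mkHomFromSingle_f, Category.assoc, Iso.inv_hom_id_assoc,
    ModuleCat.ofElement_comp, hx, h1, ← Iso.eq_inv_comp]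
  exact ModuleCat.unit_hom_ext (ModuleCat.ofElement_apply_one _)

/-- A morphism from a sphere which does not vanish in homology has a retraction. -/
theorem exists_sphere_retraction {C : ChainComplex (ModuleCat.{u} k) ℕ} {d : ℕ}
    (φ : sphere k d ⟶ C) (h : (HomologicalComplex.homologyMap φ d).hom (sphereGen d) ≠ 0) :
    ∃ ρ : C ⟶ sphere k d, φ ≫ ρ = 𝟙 _ := by
  obtain ⟨y, h1, h2⟩ := exists_cycle_sphereEval φ
  have hy : sphereEval φ ∉ LinearMap.range (C.d (d + 1) d).hom := by
    rintro ⟨x, hx⟩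
    apply h
    rw [← h2]
    have : (C.toCycles (d + 1) d).hom x = y := by
      apply (ModuleCat.mono_iff_injective (C.iCycles d)).1 inferInstance
      exact (ConcreteCategory.congr_hom (C.toCycles_i (d + 1) d) x).trans (hx.trans h1.symm)
    rw [← this]
    exact ConcreteCategory.congr_hom (C.toCycles_comp_homologyπ (d + 1) d) x
  -- A functional that vanishes on boundaries is a chain map to the sphere; it is then normalized to
  -- take the value `1` on the given cycle.
  obtain ⟨α, hα, hα'⟩ := Submodule.exists_dual_map_eq_bot_of_notMem hy inferInstance
  have hα0 : ∀ x, α ((C.d (d + 1) d).hom x) = 0 := fun x => by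
    have : α ((C.d (d + 1) d).hom x) ∈ (LinearMap.range (C.d (d + 1) d).hom).map α :=
      ⟨_, ⟨x, rfl⟩, rfl⟩
    rwa [hα'] at this
  let β : C.X d ⟶ ModuleCat.unit k :=
    ModuleCat.ofHom ((α (sphereEval φ))⁻¹ • (ULift.moduleEquiv.symm.toLinearMap ∘ₗ α))
  have hβ : ∀ x, β.hom x = ULift.up ((α (sphereEval φ))⁻¹ * α x) := fun _ => rfl
  refine ⟨HomologicalComplex.mkHomToSingle β ?_, ?_⟩
  · rintro i rfl
    refine ModuleCat.hom_ext (LinearMap.ext fun x => ?_)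
    refine (hβ ((C.d (d + 1) d).hom x)).trans ?_
    rw [hα0, mul_zero]
    rfl
  · apply HomologicalComplex.from_single_hom_ext
    rw [HomologicalComplex.comp_f, HomologicalComplex.mkHomToSingle_f, HomologicalComplex.id_f,
      ← Category.assoc, Iso.comp_inv_eq, Category.id_comp,
      ← cancel_epi (HomologicalComplex.singleObjXSelf _ d (ModuleCat.unit.{u} k)).inv,
      Iso.inv_hom_id]
    apply ModuleCat.unit_hom_ext
    refine (hβ (sphereEval φ)).trans ?_
    rw [inv_mul_cancel₀ hα]
    rfl

end ChainComplex

end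

noncomputable section

open CategoryTheory Limits Opposite AlgebraicTopology ChainComplex
open scoped Simplicial ZeroObject

namespace AlgebraicTopology.DoldKan

variable {k : Type} [Field k]

open CategoryTheory.SimplicialObject

/-! ### The homology of the tensor product with a sphere -/

/-- The constant simplicial vector space on the ground field. -/
abbrev constUnit (k : Type) [Field k] : SimplicialObject (ModuleCat.{u} k) :=
  (SimplicialObject.const _).obj (ModuleCat.unit k)

/-- The constant simplicial vector space on the ground field is a unit for the tensor product. -/
def tensorConstUnitIso (W : SimplicialObject (ModuleCat.{u} k)) :
    tensor (constUnit k) W ≅ W :=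
  NatIso.ofComponents (fun a => LinearEquiv.toModuleIso
    (X₁ := ModuleCat.of k (ULift.{u} k ⊗[k] W.obj a))
    ((TensorProduct.congr ULift.moduleEquiv (LinearEquiv.refl k (W.obj a))).trans
      (TensorProduct.lid k (W.obj a)))) (fun {a b} f => by
    ext : 1
    refine TensorProduct.ext' fun x y => ?_
    exact ((W.map f).hom.map_smul x.down y).symm)

/-- Normalized chains in positive degree are killed by the last face, which for a constant object is
the identity. -/
lemma isZero_normalizedMooreComplex_constUnit (n : ℕ) (hn : n ≠ 0) :
    IsZero (((normalizedMooreComplex _).obj (constUnit.{u} k)).X n) := by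
  obtain ⟨n, rfl⟩ := Nat.exists_eq_succ_of_ne_zero hn
  have h := HigherFacesVanish.inclusionOfMooreComplexMap (X := constUnit.{u} k) n (Fin.last n)
    (by simp)
  have h' : (inclusionOfMooreComplexMap (constUnit.{u} k)).f (n + 1) = 0 :=
    (Category.comp_id _).symm.trans h
  have : Mono ((inclusionOfMooreComplexMap (constUnit.{u} k)).f (n + 1)) := inferInstance
  exact IsZero.of_mono_eq_zero _ h'

lemma nonempty_sphere_zero_iso :
    Nonempty (sphere.{u} k 0 ≅ (normalizedMooreComplex _).obj (constUnit k)) := by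
  let e₀ := asIso (⊤ : Subobject (ModuleCat.unit.{u} k)).arrow
  let e : ((normalizedMooreComplex _).obj (constUnit.{u} k)).X 0 ≅ ModuleCat.unit k := e₀
  let φ : sphere.{u} k 0 ⟶ (normalizedMooreComplex _).obj (constUnit k) :=
    HomologicalComplex.mkHomFromSingle e.inv (fun j hj => by simp at hj)
  have : ∀ n, IsIso (φ.f n) := by
    intro n
    by_cases hn : n = 0
    · subst hn
      simp only [φ, HomologicalComplex.mkHomFromSingle_f]
      infer_instance
    · have h₁ := HomologicalComplex.isZero_single_obj_X (.down ℕ) 0 (ModuleCat.unit.{u} k) n hn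
      have h₂ := isZero_normalizedMooreComplex_constUnit.{u} (k := k) n hn
      exact ⟨0, h₁.eq_of_src _ _, h₂.eq_of_src _ _⟩
  have := HomologicalComplex.Hom.isIso_of_components φ
  exact ⟨asIso φ⟩

/-- Tensoring with a sphere shifts the homology. -/
theorem nonempty_tensorComplex_sphere_homology_iso (W : SimplicialObject (ModuleCat.{u} k))
    (d i : ℕ) : Nonempty (((tensorComplex W).obj (sphere k d)).homology (i + d) ≅
      ((alternatingFaceMapComplex _).obj W).homology i) := by
  induction d with
  | zero =>
    -- `sphere 0` is the normalized complex of the constant object `k`, the unit for the levelwise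
    -- tensor product.
    obtain ⟨e⟩ := nonempty_sphere_zero_iso.{u} (k := k)
    exact ⟨(HomologicalComplex.homologyFunctor _ _ i).mapIso
      ((tensorComplex W).mapIso e ≪≫ tensorComplexIso _ W ≪≫
        (alternatingFaceMapComplex _).mapIso (tensorConstUnitIso W))⟩
  | succ d ih =>
    obtain ⟨e⟩ := ih
    have h := tensorComplex_exactAt W (disk_exactAt.{u} k d)
    -- The connecting map is an isomorphism because the disk stays acyclic after tensoring.
    exact ⟨(shortExact_map_tensorComplex W (diskSequence_shortExact k d)).δIso (i + d + 1) (i + d)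
      rfl (h _).isZero_homology (h _).isZero_homology ≪≫ e⟩

/-- In degree `0` exactness means that `d 1 0` is epi, which passes to quotients; no connecting map
is available there. -/
lemma exactAt_zero_of_shortExact {S : ShortComplex (ChainComplex (ModuleCat.{u} k) ℕ)}
    (hS : S.ShortExact) (h : S.X₂.ExactAt 0) : S.X₃.ExactAt 0 := by
  rw [HomologicalComplex.exactAt_iff' _ 1 0 0 (by simp) (by simp),
    ShortComplex.exact_iff_epi _ (S.X₂.shape 0 0 (by simp))] at h
  rw [HomologicalComplex.exactAt_iff' _ 1 0 0 (by simp) (by simp),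
    ShortComplex.exact_iff_epi _ (S.X₃.shape 0 0 (by simp))]
  have hg := hS.epi_g
  have h1 : Epi (S.X₂.d 1 0 ≫ S.g.f 0) := by
    have : Epi (S.X₂.d 1 0) := h
    infer_instance
  rw [← HomologicalComplex.Hom.comm] at h1
  exact epi_of_epi (S.g.f 1) (S.X₃.d 1 0)

/-- The homology of the tensor product with a sphere vanishes below the degree of the sphere. -/
theorem tensorComplex_sphere_exactAt (W : SimplicialObject (ModuleCat.{u} k))
    (d i : ℕ) (hi : i < d) : ((tensorComplex W).obj (sphere k d)).ExactAt i := by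
  induction d generalizing i with
  | zero => simp at hi
  | succ d ih =>
    have hS := shortExact_map_tensorComplex W (diskSequence_shortExact.{u} k d)
    have h := tensorComplex_exactAt W (disk_exactAt.{u} k d)
    cases i with
    | zero =>
      exact exactAt_zero_of_shortExact hS (h 0)
    | succ i =>
      rw [HomologicalComplex.exactAt_iff_isZero_homology]
      exact ((ih i (by omega)).isZero_homology).of_iso
        (hS.δIso (i + 1) i rfl (h _).isZero_homology (h _).isZero_homology)

end AlgebraicTopology.DoldKan

/-! ### Finiteness of the homology of tensor products -/

namespace ChainComplex

variable {k : Type} [Field k]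

/-- The total homology of a complex of vector spaces is finite dimensional. -/
def HasFiniteHomology (C : ChainComplex (ModuleCat.{u} k) ℕ) : Prop :=
  (∀ i, FiniteDimensional k (C.homology i)) ∧ {i | Nontrivial (C.homology i)}.Finite

lemma hasFiniteHomology_of_exactAt {C : ChainComplex (ModuleCat.{u} k) ℕ}
    (h : ∀ i, C.ExactAt i) : HasFiniteHomology C := by
  have h' : ∀ i, Subsingleton (C.homology i) := fun i =>
    ModuleCat.subsingleton_of_isZero (h i).isZero_homology
  refine ⟨fun i => inferInstance, ?_⟩
  convert Set.finite_empty
  ext i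
  simpa [not_nontrivial_iff_subsingleton] using h' i

lemma HasFiniteHomology.of_iso {C D : ChainComplex (ModuleCat.{u} k) ℕ}
    (hC : HasFiniteHomology C) (e : ∀ i, C.homology i ≅ D.homology i) : HasFiniteHomology D := by
  refine ⟨fun i => ?_, hC.2.subset fun i hi => ?_⟩
  · have := hC.1 i
    exact (e i).toLinearEquiv.finiteDimensional
  · have : Nontrivial (D.homology i) := hi
    exact (e i).toLinearEquiv.symm.toEquiv.symm.nontrivial

lemma HasFiniteHomology.of_shortExact {S : ShortComplex (ChainComplex (ModuleCat.{u} k) ℕ)}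
    (hS : S.ShortExact) (h₁ : HasFiniteHomology S.X₁) (h₃ : HasFiniteHomology S.X₃) :
    HasFiniteHomology S.X₂ := by
  have hex : ∀ i, Function.Exact (HomologicalComplex.homologyMap S.f i).hom
      (HomologicalComplex.homologyMap S.g i).hom := fun i =>
    (ShortComplex.ShortExact.moduleCat_exact_iff_function_exact _).1 (hS.homology_exact₂ i)
  refine ⟨fun i => ?_, (h₁.2.union h₃.2).subset fun i hi => ?_⟩
  · have := h₁.1 i
    have := h₃.1 i
    -- The map to the homology of `S.X₃` need not be onto, so it is restricted to its range.
    exact Module.Finite.of_exact (g := (HomologicalComplex.homologyMap S.g i).hom.rangeRestrict)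
      (fun x => Subtype.ext_iff.trans (hex i x)) (LinearMap.surjective_rangeRestrict _)
  · by_contra h
    simp only [Set.mem_union, Set.mem_ofPred_eq, not_or, not_nontrivial_iff_subsingleton] at h
    obtain ⟨h1, h3⟩ := h
    have : Nontrivial (S.X₂.homology i) := hi
    obtain ⟨x, hx⟩ := exists_ne (0 : S.X₂.homology i)
    obtain ⟨y, hy⟩ := (hex i x).1 (Subsingleton.elim _ _)
    apply hx
    rw [← hy, Subsingleton.elim y 0, map_zero]

end ChainComplex

namespace AlgebraicTopology.DoldKan

variable {k : Type} [Field k]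

lemma hasFiniteHomology_tensorComplex_sphere {W : SimplicialObject (ModuleCat.{u} k)}
    (hW : HasFiniteHomology ((alternatingFaceMapComplex _).obj W)) (d : ℕ) :
    HasFiniteHomology ((tensorComplex W).obj (sphere k d)) := by
  refine ⟨fun i => ?_, (hW.2.image (· + d)).subset fun i hi => ?_⟩
  · by_cases hi : i < d
    · have := ModuleCat.subsingleton_of_isZero
        (tensorComplex_sphere_exactAt W d i hi).isZero_homology
      infer_instance
    · obtain ⟨j, rfl⟩ := Nat.exists_eq_add_of_le' (not_lt.1 hi)
      obtain ⟨e⟩ := nonempty_tensorComplex_sphere_homology_iso W d j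
      have := hW.1 j
      exact e.symm.toLinearEquiv.finiteDimensional
  · have hi' : Nontrivial (((tensorComplex W).obj (sphere k d)).homology i) := hi
    by_cases h : i < d
    · exact absurd (ModuleCat.subsingleton_of_isZero
        (tensorComplex_sphere_exactAt W d i h).isZero_homology)
        (not_subsingleton_iff_nontrivial.2 hi')
    · obtain ⟨j, rfl⟩ := Nat.exists_eq_add_of_le' (not_lt.1 h)
      obtain ⟨e⟩ := nonempty_tensorComplex_sphere_homology_iso W d j
      exact ⟨j, e.toLinearEquiv.symm.toEquiv.nontrivial, rfl⟩

/-- If `C` has finite dimensional homology, then so does its tensor product with `W`. -/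
theorem hasFiniteHomology_tensorComplex {W : SimplicialObject (ModuleCat.{u} k)}
    (hW : HasFiniteHomology ((alternatingFaceMapComplex _).obj W))
    {C : ChainComplex (ModuleCat.{u} k) ℕ} (hC : HasFiniteHomology C) :
    HasFiniteHomology ((tensorComplex W).obj C) := by
  obtain ⟨hf, hb⟩ := hC
  obtain ⟨B, hB⟩ := hb.bddAbove
  replace hB : ∀ i, B < i → Subsingleton (C.homology i) := fun i hi =>
    not_nontrivial_iff_subsingleton.1 fun h => (hB h).not_gt hi
  clear hb
  -- The induction is on the total dimension of the homology; the bound `B` is kept fixed so that it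
  -- remains a finite sum.
  obtain ⟨N, hN⟩ : ∃ N, ∑ i ∈ Finset.range (B + 1), Module.finrank k (C.homology i) = N := ⟨_, rfl⟩
  induction N using Nat.strong_induction_on generalizing C with
  | _ N ih =>
    by_cases hz : ∀ i, C.ExactAt i
    · exact hasFiniteHomology_of_exactAt (tensorComplex_exactAt W hz)
    push Not at hz
    obtain ⟨d, hd⟩ := hz
    have hd' : ¬ Subsingleton (C.homology d) := fun h => hd
      ((C.exactAt_iff_isZero_homology d).2 (ModuleCat.isZero_of_subsingleton _))
    have hdB : d ≤ B := not_lt.1 fun h => hd' (hB d h)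
    have := not_subsingleton_iff_nontrivial.1 hd'
    obtain ⟨z, hz⟩ := exists_ne (0 : C.homology d)
    obtain ⟨φ, hφ⟩ := exists_sphere_hom z
    obtain ⟨ρ, hρ⟩ := exists_sphere_retraction φ (by rwa [hφ])
    -- The nonzero class `z` splits off a sphere. The quotient has strictly smaller homology in
    -- degree `d`, because `z` maps to zero there.
    let S : ShortComplex (ChainComplex (ModuleCat.{u} k) ℕ) :=
      ShortComplex.mk φ (cokernel.π φ) (cokernel.condition φ)
    have hmono : Mono φ := (SplitMono.mk ρ hρ).mono
    have hS : S.ShortExact := ShortComplex.ShortExact.mk'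
      (ShortComplex.exact_of_g_is_cokernel _ (cokernelIsCokernel φ)) hmono inferInstance
    let τ := ShortComplex.Splitting.ofExactOfRetraction S hS.exact ρ hρ inferInstance
    have hsurj : ∀ i, Function.Surjective (HomologicalComplex.homologyMap S.g i).hom := by
      intro i x
      refine ⟨(HomologicalComplex.homologyMap τ.s i).hom x, ?_⟩
      have h : HomologicalComplex.homologyMap (τ.s ≫ S.g) i = 𝟙 _ := by
        rw [τ.s_g, HomologicalComplex.homologyMap_id]
      rw [HomologicalComplex.homologyMap_comp] at h
      exact ConcreteCategory.congr_hom h x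
    have hfQ : ∀ i, FiniteDimensional k (S.X₃.homology i) := fun i => by
      have := hf i
      exact Module.Finite.of_surjective _ (hsurj i)
    have hle : ∀ i, Module.finrank k (S.X₃.homology i) ≤ Module.finrank k (C.homology i) :=
      fun i => by
        have := hf i
        exact LinearMap.finrank_le_finrank_of_surjective (hsurj i)
    have hlt : Module.finrank k (S.X₃.homology d) < Module.finrank k (C.homology d) := by
      have := hf d
      have hz0 : (HomologicalComplex.homologyMap S.g d).hom z = 0 := by
        rw [← hφ]
        have h : HomologicalComplex.homologyMap (S.f ≫ S.g) d = 0 := by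
          rw [S.zero, HomologicalComplex.homologyMap_zero]
        rw [HomologicalComplex.homologyMap_comp] at h
        exact ConcreteCategory.congr_hom h (sphereGen d)
      refine lt_of_le_of_ne (hle d) fun h => hz ?_
      exact (LinearMap.injective_iff_surjective_of_finrank_eq_finrank h.symm).2 (hsurj d)
        (hz0.trans (map_zero _).symm)
    have hQ : HasFiniteHomology ((tensorComplex W).obj S.X₃) := by
      refine ih _ ?_ hfQ (fun i hi => ?_) rfl
      · rw [← hN]
        exact Finset.sum_lt_sum (fun i _ => hle i) ⟨d, Finset.mem_range.2 (by omega), hlt⟩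
      · have := hB i hi
        exact (hsurj i).subsingleton
    exact HasFiniteHomology.of_shortExact (shortExact_map_tensorComplex W hS)
      (hasFiniteHomology_tensorComplex_sphere hW d) hQ

end AlgebraicTopology.DoldKan

end

noncomputable section

open CategoryTheory Limits Opposite AlgebraicTopology ChainComplex
open scoped Simplicial ZeroObject

/-! ### Singular chains as simplicial vector spaces -/

namespace ModuleCat

variable (k : Type) [Field k]

/-- The free vector space functor. -/
def finsuppFunctor : Type u ⥤ ModuleCat.{u} k where
  obj S := of k (S →₀ k)
  map f := ofHom (Finsupp.lmapDomain k k f)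
  map_id S := by
    ext : 1
    exact Finsupp.lmapDomain_id k k
  map_comp f g := by
    ext : 1
    exact Finsupp.lmapDomain_comp k k f g

/-- The free vector space on a type is a coproduct of copies of the ground field. -/
def sigmaConstIso : sigmaConst.obj (unit.{u} k) ≅ finsuppFunctor k :=
  NatIso.ofComponents (fun S =>
    { hom := Sigma.desc fun s => ofElement (A := of k (S →₀ k)) (Finsupp.single s 1)
      inv := ofHom (Finsupp.lsum k fun s =>
        (Sigma.ι (fun _ : S => unit.{u} k) s).hom ∘ₗ ULift.moduleEquiv.symm.toLinearMap)
      hom_inv_id := by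
        refine Sigma.hom_ext _ _ fun s => unit_hom_ext ?_
        refine Eq.trans (congrArg (Finsupp.lsum k fun s => (Sigma.ι (fun _ : S => unit.{u} k) s).hom ∘ₗ
          ULift.moduleEquiv.symm.toLinearMap) ((ConcreteCategory.congr_hom (Sigma.ι_desc (fun s =>
          ofElement (A := of k (S →₀ k)) (Finsupp.single s 1)) s) (ULift.up (1 : k))).trans
            (ofElement_apply_one _))) ?_
        exact (Finsupp.lsum_single _ _ _ _).trans
          (congrArg (Sigma.ι (fun _ : S => unit.{u} k) s).hom rfl)
      inv_hom_id := by
        ext : 1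
        refine Finsupp.lhom_ext' fun s => LinearMap.ext_ring ?_
        refine (congrArg _ (Finsupp.lsum_single _ _ _ _)).trans ?_
        refine (ConcreteCategory.congr_hom (Sigma.ι_desc (fun s =>
          ofElement (A := of k (S →₀ k)) (Finsupp.single s 1)) s) (ULift.up (1 : k))).trans ?_
        exact ofElement_apply_one _ })
    (fun {S T} f => by
      refine Sigma.hom_ext _ _ fun s => unit_hom_ext ?_
      have h : Sigma.ι (fun _ : S => unit.{u} k) s ≫ (sigmaConst.obj (unit.{u} k)).map f =
          Sigma.ι (fun _ : T => unit.{u} k) (f s) :=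
        (Sigma.ι_comp_map' _ _ _).trans (Category.id_comp _)
      refine (congrArg (Sigma.desc fun t => ofElement (A := of k (T →₀ k)) (Finsupp.single t 1)).hom
        (ConcreteCategory.congr_hom h (ULift.up (1 : k)))).trans ?_
      refine ((ConcreteCategory.congr_hom (Sigma.ι_desc (fun t =>
        ofElement (A := of k (T →₀ k)) (Finsupp.single t 1)) (f s)) (ULift.up (1 : k))).trans
          (ofElement_apply_one _)).trans ?_
      refine Eq.trans ?_ (congrArg (Finsupp.lmapDomain k k f)
        ((ConcreteCategory.congr_hom (Sigma.ι_desc (fun s =>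
          ofElement (A := of k (S →₀ k)) (Finsupp.single s 1)) s) (ULift.up (1 : k))).trans
            (ofElement_apply_one _))).symm
      exact Finsupp.mapDomain_single.symm)

/-- Stated for arbitrary maps of sets so as to serve both for the simplicial operators and for maps
of spaces. -/
lemma finsuppTensor_naturality {S S' T T' U U' : Type u} (e : S × T ≃ U) (e' : S' × T' ≃ U')
    (f : S → S') (g : T → T') (h : U → U') (H : ∀ s t, e' (f s, g t) = h (e (s, t))) :
    ((finsuppTensorFinsupp' k S' T').trans (Finsupp.domLCongr e')).toLinearMap ∘ₗ
      TensorProduct.map (Finsupp.lmapDomain k k f) (Finsupp.lmapDomain k k g) =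
    Finsupp.lmapDomain k k h ∘ₗ
      ((finsuppTensorFinsupp' k S T).trans (Finsupp.domLCongr e)).toLinearMap := by
  ext s t : 5
  simp [finsuppTensorFinsupp'_single_tmul_single, Finsupp.mapDomain_single, Finsupp.lmapDomain_apply, H]

end ModuleCat

namespace TopCat

variable (k : Type) [Field k]

open CategoryTheory.SimplicialObject

/-- The simplicial vector space of singular chains. -/
def chains : TopCat.{u} ⥤ SimplicialObject (ModuleCat.{u} k) :=
  toSSet ⋙ (SimplicialObject.whiskering _ _).obj (ModuleCat.finsuppFunctor k)

/-- Singular homology, through free vector spaces. -/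
def chainsHomologyIso (i : ℕ) :
    chains.{u} k ⋙ alternatingFaceMapComplex _ ⋙ HomologicalComplex.homologyFunctor _ _ i ≅
      (singularHomologyFunctor (ModuleCat.{u} k) i).obj (ModuleCat.unit k) :=
  Functor.isoWhiskerLeft toSSet (Functor.isoWhiskerRight
    ((SimplicialObject.whiskering _ _).mapIso (ModuleCat.sigmaConstIso k).symm)
    (alternatingFaceMapComplex _ ⋙ HomologicalComplex.homologyFunctor _ _ i))

/-- Singular simplices of a product. -/
def toSSetProdEquiv (X Y : TopCat.{u}) (a : SimplexCategoryᵒᵖ) :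
    (toSSet.obj X).obj a × (toSSet.obj Y).obj a ≃ (toSSet.obj (of (X × Y))).obj a where
  toFun p := ULift.up (ofHom (p.1.down.hom.prodMk p.2.down.hom))
  invFun q := (ULift.up (ofHom (ContinuousMap.fst.comp q.down.hom)),
    ULift.up (ofHom (ContinuousMap.snd.comp q.down.hom)))
  left_inv _ := rfl
  right_inv _ := rfl

/-- The simplicial Künneth isomorphism for singular chains. -/
def chainsProdIso (X Y : TopCat.{u}) :
    tensor ((chains k).obj X) ((chains k).obj Y) ≅ (chains k).obj (of (X × Y)) :=
  NatIso.ofComponents (fun a => LinearEquiv.toModuleIso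
    (X₁ := ModuleCat.of k (((toSSet.obj X).obj a →₀ k) ⊗[k] ((toSSet.obj Y).obj a →₀ k)))
    (X₂ := ModuleCat.of k ((toSSet.obj (of (X × Y))).obj a →₀ k))
    ((finsuppTensorFinsupp' k _ _).trans (Finsupp.domLCongr (toSSetProdEquiv X Y a))))
    (fun {a b} f => by
      ext : 1
      exact ModuleCat.finsuppTensor_naturality k (toSSetProdEquiv X Y a) (toSSetProdEquiv X Y b)
        ((toSSet.obj X).map f) ((toSSet.obj Y).map f) ((toSSet.obj (of (X × Y))).map f)
        fun _ _ => rfl)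

lemma chainsProdIso_naturality {X X' Y Y' : TopCat.{u}} (f : X ⟶ X') (g : Y ⟶ Y') :
    tensorMap ((chains k).map f) ((chains k).map g) ≫ (chainsProdIso k X' Y').hom =
      (chainsProdIso k X Y).hom ≫ (chains k).map (ofHom (f.hom.prodMap g.hom)) := by
  ext a : 2
  exact ModuleCat.finsuppTensor_naturality k (toSSetProdEquiv X Y a) (toSSetProdEquiv X' Y' a)
    ((toSSet.map f).app a) ((toSSet.map g).app a)
    ((toSSet.map (ofHom (f.hom.prodMap g.hom))).app a) fun _ _ => rfl

end TopCat

end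

/-! ### Naturality of the homology of a product -/

noncomputable section

open CategoryTheory Limits Opposite AlgebraicTopology ChainComplex
open scoped Simplicial ZeroObject

namespace AlgebraicTopology.DoldKan

variable {k : Type} [Field k]

open CategoryTheory.SimplicialObject

lemma tensorComplexIso_naturality_left {V V' : SimplicialObject (ModuleCat.{u} k)} (f : V ⟶ V')
    (W : SimplicialObject (ModuleCat.{u} k)) :
    (tensorComplex W).map ((normalizedMooreComplex _).map f) ≫ (tensorComplexIso V' W).hom =
      (tensorComplexIso V W).hom ≫ (alternatingFaceMapComplex _).map (tensorMap f (𝟙 W)) := by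
  have h := congrArg (tensorFunctor W ⋙ alternatingFaceMapComplex _).map
    (CategoryTheory.Abelian.DoldKan.equivalence.unitIso.inv.naturality f)
  rw [CategoryTheory.Functor.map_comp, CategoryTheory.Functor.map_comp] at h
  exact h

lemma tensorComplexIso_naturality_right (V : SimplicialObject (ModuleCat.{u} k))
    {W W' : SimplicialObject (ModuleCat.{u} k)} (g : W ⟶ W') :
    (tensorComplexMap g).app ((normalizedMooreComplex _).obj V) ≫ (tensorComplexIso V W').hom =
      (tensorComplexIso V W).hom ≫ (alternatingFaceMapComplex _).map (tensorMap (𝟙 V) g) := by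
  let φ := CategoryTheory.Abelian.DoldKan.equivalence.unitIso.inv.app V
  have h : tensorMap (𝟙 _) g ≫ tensorMap φ (𝟙 W') = tensorMap φ (𝟙 W) ≫ tensorMap (𝟙 V) g := by
    rw [← tensorMap_comp, ← tensorMap_comp]
    simp only [Category.comp_id, Category.id_comp]
    exact congrArg (tensorMap · g) (Category.id_comp φ)
  exact ((alternatingFaceMapComplex _).map_comp _ _).symm.trans
    ((congrArg (alternatingFaceMapComplex _).map h).trans
      ((alternatingFaceMapComplex _).map_comp _ _))

/-- A map which kills the class of a sphere also kills the classes coming from this sphere in the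
homology of the tensor product. -/
lemma homologyMap_tensorComplex_eq_zero (W : SimplicialObject (ModuleCat.{u} k))
    {C : ChainComplex (ModuleCat.{u} k) ℕ} {d : ℕ} (φ : sphere k d ⟶ C)
    (h : (HomologicalComplex.homologyMap φ d).hom (sphereGen d) = 0) (i : ℕ) :
    HomologicalComplex.homologyMap ((tensorComplex W).map φ) i = 0 := by
  obtain ⟨ψ, rfl⟩ := exists_disk_factorization φ h
  rw [CategoryTheory.Functor.map_comp, HomologicalComplex.homologyMap_comp]
  rw [(tensorComplex_exactAt W (disk_exactAt.{u} k d) i).isZero_homology.eq_zero_of_tgt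
    (HomologicalComplex.homologyMap _ i), zero_comp]

end AlgebraicTopology.DoldKan

namespace TopCat

variable (k : Type) [Field k]

open CategoryTheory.SimplicialObject AlgebraicTopology.DoldKan

/-- The homology of a product of spaces. -/
def prodHomologyIso (X Y : TopCat.{u}) (i : ℕ) :
    ((tensorComplex ((chains k).obj Y)).obj
      ((normalizedMooreComplex _).obj ((chains k).obj X))).homology i ≅
      ((singularHomologyFunctor (ModuleCat.{u} k) i).obj (ModuleCat.unit k)).obj (of (X × Y)) :=
  (HomologicalComplex.homologyFunctor _ _ i).mapIso (tensorComplexIso _ _ ≪≫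
    (alternatingFaceMapComplex _).mapIso (chainsProdIso k X Y)) ≪≫
      (chainsHomologyIso k i).app (of (X × Y))

/-- Singular homology, through normalized chains. -/
def normalizedChainsHomologyIso (i : ℕ) :
    chains.{u} k ⋙ normalizedMooreComplex _ ⋙ HomologicalComplex.homologyFunctor _ _ i ≅
      (singularHomologyFunctor (ModuleCat.{u} k) i).obj (ModuleCat.unit k) :=
  Functor.isoWhiskerLeft (chains k) (NatIso.ofComponents
    (G := alternatingFaceMapComplex _ ⋙ HomologicalComplex.homologyFunctor _ _ i)
    (fun V => homologyNormalizedIso V i) fun {V V'} f => by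
      have h := congrArg (HomologicalComplex.homologyFunctor _ _ i).map
        ((inclusionOfMooreComplex (ModuleCat.{u} k)).naturality f)
      rw [CategoryTheory.Functor.map_comp, CategoryTheory.Functor.map_comp] at h
      exact h) ≪≫ chainsHomologyIso k i

lemma prodHomologyIso_naturality_left {X X' : TopCat.{u}} (f : X ⟶ X') (Y : TopCat.{u}) (i : ℕ) :
    HomologicalComplex.homologyMap ((tensorComplex ((chains k).obj Y)).map
      ((normalizedMooreComplex _).map ((chains k).map f))) i ≫ (prodHomologyIso k X' Y i).hom =
    (prodHomologyIso k X Y i).hom ≫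
      ((singularHomologyFunctor (ModuleCat.{u} k) i).obj (ModuleCat.unit k)).map
        (ofHom (Y := of (X' × Y)) (f.hom.prodMap (ContinuousMap.id Y))) := by
  have h1 := tensorComplexIso_naturality_left ((chains k).map f) ((chains k).obj Y)
  have h2 := congrArg (alternatingFaceMapComplex _).map (chainsProdIso_naturality k f (𝟙 Y))
  rw [CategoryTheory.Functor.map_id, Functor.map_comp, Functor.map_comp] at h2
  have h3 := (chainsHomologyIso k i).hom.naturality (ofHom (f.hom.prodMap (ContinuousMap.id Y)))
  exact ((((CommSq.mk h1.symm).horiz_comp (CommSq.mk h2.symm)).map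
    (HomologicalComplex.homologyFunctor _ _ i)).horiz_comp (CommSq.mk h3.symm)).w.symm

lemma prodHomologyIso_naturality_right (X : TopCat.{u}) {Y Y' : TopCat.{u}} (g : Y ⟶ Y') (i : ℕ) :
    HomologicalComplex.homologyMap ((tensorComplexMap ((chains k).map g)).app
      ((normalizedMooreComplex _).obj ((chains k).obj X))) i ≫ (prodHomologyIso k X Y' i).hom =
    (prodHomologyIso k X Y i).hom ≫
      ((singularHomologyFunctor (ModuleCat.{u} k) i).obj (ModuleCat.unit k)).map
        (ofHom ((ContinuousMap.id X).prodMap g.hom)) := by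
  have h1 := tensorComplexIso_naturality_right ((chains k).obj X) ((chains k).map g)
  have h2 := congrArg (alternatingFaceMapComplex _).map (chainsProdIso_naturality k (𝟙 X) g)
  rw [CategoryTheory.Functor.map_id, Functor.map_comp, Functor.map_comp] at h2
  have h3 := (chainsHomologyIso k i).hom.naturality (ofHom ((ContinuousMap.id X).prodMap g.hom))
  exact ((((CommSq.mk h1.symm).horiz_comp (CommSq.mk h2.symm)).map
    (HomologicalComplex.homologyFunctor _ _ i)).horiz_comp (CommSq.mk h3.symm)).w.symm

end TopCat

/-! ### Finite homology of powers, and cross products -/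

namespace RelHilali

open TopCat AlgebraicTopology.DoldKan CategoryTheory.SimplicialObject

variable {X Y Z : Type u} [TopologicalSpace X] [TopologicalSpace Y] [TopologicalSpace Z]

lemma ratHomologyMap_comp (i : ℕ) (g : C(Y, Z)) (f : C(X, Y)) :
    ratHomologyMap i (g.comp f) = ratHomologyMap i g ∘ₗ ratHomologyMap i f := by
  simp only [ratHomologyMap]
  rw [← ModuleCat.hom_comp, ← CategoryTheory.Functor.map_comp]
  rfl

lemma ratHomologyMap_id (i : ℕ) : ratHomologyMap i (ContinuousMap.id X) = LinearMap.id :=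
  congrArg ModuleCat.Hom.hom (CategoryTheory.Functor.map_id
    ((singularHomologyFunctor (ModuleCat.{u} ℚ) i).obj (ModuleCat.unit ℚ)) (TopCat.of X))

lemma hasFiniteHomologyRank_iff :
    HasFiniteHomologyRank X ↔ HasFiniteHomology
      ((alternatingFaceMapComplex _).obj ((chains ℚ).obj (TopCat.of X))) := by
  let e (i : ℕ) := ((chainsHomologyIso ℚ i).app (TopCat.of X)).toLinearEquiv
  constructor
  · intro h
    refine ⟨fun i => ?_, h.2.subset fun i hi => ?_⟩
    · have := h.1 i
      exact (e i).symm.finiteDimensional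
    · exact @Equiv.nontrivial _ _ (e i).symm.toEquiv hi
  · intro h
    refine ⟨fun i => ?_, h.2.subset fun i hi => ?_⟩
    · have : FiniteDimensional ℚ ((chains ℚ ⋙ alternatingFaceMapComplex _ ⋙
        HomologicalComplex.homologyFunctor _ _ i).obj (TopCat.of X)) := h.1 i
      exact (e i).finiteDimensional
    · exact @Equiv.nontrivial _ _ (e i).toEquiv hi

lemma HasFiniteHomologyRank.of_homeomorph (h : HasFiniteHomologyRank X) (e : X ≃ₜ Y) :
    HasFiniteHomologyRank Y := by
  rw [hasFiniteHomologyRank_iff] at h ⊢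
  exact h.of_iso fun i => (chains ℚ ⋙ alternatingFaceMapComplex _ ⋙
    HomologicalComplex.homologyFunctor _ _ i).mapIso
      (TopCat.isoOfHomeo (X := TopCat.of X) (Y := TopCat.of Y) e)

lemma HasFiniteHomologyRank.prod (hX : HasFiniteHomologyRank X) (hY : HasFiniteHomologyRank Y) :
    HasFiniteHomologyRank (X × Y) := by
  rw [hasFiniteHomologyRank_iff] at hX hY ⊢
  exact (hasFiniteHomology_tensorComplex hY
    (hX.of_iso fun i => (homologyNormalizedIso _ i).symm)).of_iso fun i =>
      prodHomologyIso ℚ (TopCat.of X) (TopCat.of Y) i ≪≫ ((chainsHomologyIso ℚ i).app _).symm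

lemma subsingleton_ratHomology [TotallyDisconnectedSpace X] {i : ℕ} (hi : i ≠ 0) :
    Subsingleton (ratHomology i X) :=
  ModuleCat.subsingleton_of_isZero
    (isZero_singularHomologyFunctor_of_totallyDisconnectedSpace _ i _ (TopCat.of X) hi)

lemma hasFiniteHomologyRank_of_finite [TotallyDisconnectedSpace X] [Finite X] :
    HasFiniteHomologyRank X := by
  refine ⟨fun i => ?_, (Set.finite_singleton 0).subset fun i hi => ?_⟩
  · by_cases hi : i = 0
    · subst hi
      have : FiniteDimensional ℚ ((ModuleCat.finsuppFunctor ℚ).obj X) :=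
        inferInstanceAs (FiniteDimensional ℚ (X →₀ ℚ))
      exact (singularHomologyFunctorZeroOfTotallyDisconnectedSpace _ (ModuleCat.unit ℚ)
        (TopCat.of X) ≪≫ (ModuleCat.sigmaConstIso ℚ).app X).symm.toLinearEquiv.finiteDimensional
    · have := subsingleton_ratHomology (X := X) hi
      infer_instance
  · by_contra h
    exact not_nontrivial_iff_subsingleton.2 (subsingleton_ratHomology (X := X) h) hi

lemma HasFiniteHomologyRank.pi (hX : HasFiniteHomologyRank X) (n : ℕ) :
    HasFiniteHomologyRank (Fin n → X) := by
  induction n with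
  | zero => exact hasFiniteHomologyRank_of_finite
  | succ n ih =>
    refine (hX.prod ih).of_homeomorph
      { toEquiv := Fin.consEquiv fun _ => X
        continuous_toFun := ?_
        continuous_invFun := ?_ }
    · refine continuous_pi fun i => ?_
      refine Fin.cases ?_ (fun i => ?_) i
      · exact continuous_fst
      · exact (continuous_apply i).comp continuous_snd
    · exact (continuous_apply 0).prodMk (continuous_pi fun i => continuous_apply i.succ)

/-- The cross product with itself of a homology class killed by `f`. -/
theorem exists_cross_class (f : C(X, Y)) {d : ℕ} (hd : d ≠ 0) {z : ratHomology d X} (hz : z ≠ 0)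
    (hf : ratHomologyMap d f z = 0) :
    ∃ w : ratHomology (d + d) (X × X), w ≠ 0 ∧ ratHomologyMap (d + d) (f.prodMap f) w = 0 ∧
      ratHomologyMap (d + d) (ContinuousMap.fst : C(X × X, X)) w = 0 ∧
      ratHomologyMap (d + d) (ContinuousMap.snd : C(X × X, X)) w = 0 := by
  have h0 {A B : ModuleCat.{u} ℚ} (φ : A →ₗ[ℚ] B) {a : A} (ha : a = 0) : φ a = 0 := by
    rw [ha, map_zero]
  let e := normalizedChainsHomologyIso.{u} ℚ d
  let W := (chains ℚ).obj (TopCat.of X)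
  obtain ⟨ζ, hζ⟩ := exists_sphere_hom ((e.app (TopCat.of X)).inv.hom z)
  have hζ' : (e.app (TopCat.of X)).hom.hom ((HomologicalComplex.homologyMap ζ d).hom
      (sphereGen d)) = z := by
    rw [hζ]
    exact (e.app (TopCat.of X)).toLinearEquiv.apply_symm_apply z
  have hζ0 : (HomologicalComplex.homologyMap ζ d).hom (sphereGen d) ≠ 0 := fun h =>
    hz (hζ'.symm.trans ((congrArg _ h).trans (map_zero _)))
  obtain ⟨ρ, hρ⟩ := exists_sphere_retraction ζ hζ0
  obtain ⟨ε⟩ := nonempty_tensorComplex_sphere_homology_iso W d d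
  -- `v` is `z` in the second factor, seen in degree `2d` of the tensor product with `sphere d`; its
  -- image `v'` under `ζ` represents `z × z`. The retraction `ρ` shows `v' ≠ 0`.
  let v := ε.inv.hom ((chainsHomologyIso ℚ d).inv.app (TopCat.of X) z)
  have hv : v ≠ 0 := fun h => hz
    (((chainsHomologyIso ℚ d).app (TopCat.of X)).symm.toLinearEquiv.map_eq_zero_iff.1
      (ε.symm.toLinearEquiv.map_eq_zero_iff.1 h))
  let v' := (HomologicalComplex.homologyMap ((tensorComplex W).map ζ) (d + d)).hom v
  have hv' : v' ≠ 0 := by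
    intro h
    refine hv ?_
    have h1 := congrArg (fun φ => HomologicalComplex.homologyMap ((tensorComplex W).map φ) (d + d)) hρ
    simp only [CategoryTheory.Functor.map_comp, CategoryTheory.Functor.map_id,
      HomologicalComplex.homologyMap_comp, HomologicalComplex.homologyMap_id] at h1
    exact (ConcreteCategory.congr_hom h1 v).symm.trans
      (h0 (HomologicalComplex.homologyMap ((tensorComplex W).map ρ) (d + d)).hom h)
  -- a map on the first factor which kills `z` kills the cross product
  have hkill : ∀ {Z : Type u} [TopologicalSpace Z] (g : C(X, Z)), ratHomologyMap d g z = 0 →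
      ratHomologyMap (d + d) (g.prodMap (ContinuousMap.id X))
        ((prodHomologyIso ℚ (TopCat.of X) (TopCat.of X) (d + d)).hom.hom v') = 0 := by
    intro Z _ g hg
    have h1 := ConcreteCategory.congr_hom
      (prodHomologyIso_naturality_left ℚ (TopCat.ofHom g) (TopCat.of X) (d + d)) v'
    refine h1.symm.trans ?_
    have h2 : (HomologicalComplex.homologyMap (ζ ≫ (normalizedMooreComplex _).map
        ((chains ℚ).map (TopCat.ofHom g))) d).hom (sphereGen d) = 0 := by
      rw [HomologicalComplex.homologyMap_comp]
      refine (e.app (TopCat.of Z)).toLinearEquiv.map_eq_zero_iff.1 ?_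
      refine (ConcreteCategory.congr_hom (e.hom.naturality (TopCat.ofHom g)) _).trans ?_
      exact (congrArg _ hζ').trans hg
    have h3 := homologyMap_tensorComplex_eq_zero W _ h2 (d + d)
    rw [CategoryTheory.Functor.map_comp, HomologicalComplex.homologyMap_comp] at h3
    exact h0 (prodHomologyIso ℚ (TopCat.of Z) (TopCat.of X) (d + d)).hom.hom
      (ConcreteCategory.congr_hom h3 v)
  refine ⟨(prodHomologyIso ℚ (TopCat.of X) (TopCat.of X) (d + d)).hom.hom v', ?_, ?_, ?_, ?_⟩
  · exact fun h => hv'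
      ((prodHomologyIso ℚ (TopCat.of X) (TopCat.of X) (d + d)).toLinearEquiv.map_eq_zero_iff.1 h)
  -- Since `f × f = (id × f) ∘ (f × id)`, killing the first factor suffices.
  · have h : ratHomologyMap (d + d) (f.prodMap f) =
        ratHomologyMap (d + d) ((ContinuousMap.id Y).prodMap f) ∘ₗ
          ratHomologyMap (d + d) (f.prodMap (ContinuousMap.id X)) := by
      rw [← ratHomologyMap_comp]
      congr 1
    rw [h, LinearMap.comp_apply, hkill f hf, map_zero]
  -- The first projection factors through `X × pt`. By naturality the class comes from `sphere d`
  -- tensored with the chains of a point, whose homology in degree `2d` is `H_d(pt) = 0`.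
  · let c : C(X, PUnit.{u + 1}) := ContinuousMap.const X PUnit.unit
    have h : ratHomologyMap (d + d) (ContinuousMap.fst : C(X × X, X)) =
        ratHomologyMap (d + d) (ContinuousMap.fst : C(X × PUnit.{u + 1}, X)) ∘ₗ
          ratHomologyMap (d + d) ((ContinuousMap.id X).prodMap c) := by
      rw [← ratHomologyMap_comp]
      congr 1
    rw [h, LinearMap.comp_apply]
    refine h0 (ratHomologyMap _ _) ?_
    have h1 := ConcreteCategory.congr_hom
      (prodHomologyIso_naturality_right ℚ (TopCat.of X) (TopCat.ofHom c) (d + d)) v'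
    refine h1.symm.trans
      (h0 (prodHomologyIso ℚ (TopCat.of X) (TopCat.of PUnit.{u + 1}) (d + d)).hom.hom ?_)
    have h2 := congrArg (fun φ => HomologicalComplex.homologyMap φ (d + d))
      ((tensorComplexMap ((chains ℚ).map (TopCat.ofHom c))).naturality ζ)
    simp only [HomologicalComplex.homologyMap_comp] at h2
    refine (ConcreteCategory.congr_hom h2 v).trans (h0 (HomologicalComplex.homologyMap
      ((tensorComplex _).map ζ) (d + d)).hom ?_)
    obtain ⟨ε'⟩ := nonempty_tensorComplex_sphere_homology_iso
      ((chains ℚ).obj (TopCat.of PUnit.{u + 1})) d d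
    have := subsingleton_ratHomology (X := PUnit.{u + 1}) hd
    exact (ε'.toLinearEquiv.toEquiv.trans ((chainsHomologyIso ℚ d).app
      (TopCat.of PUnit.{u + 1})).toLinearEquiv.toEquiv).subsingleton.elim _ _
  · let c : C(X, PUnit.{u + 1}) := ContinuousMap.const X PUnit.unit
    have := subsingleton_ratHomology (X := PUnit.{u + 1}) hd
    have h : ratHomologyMap (d + d) (ContinuousMap.snd : C(X × X, X)) =
        ratHomologyMap (d + d) (ContinuousMap.snd : C(PUnit.{u + 1} × X, X)) ∘ₗ
          ratHomologyMap (d + d) (c.prodMap (ContinuousMap.id X)) := by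
      rw [← ratHomologyMap_comp]
      congr 1
    -- For the second projection, the map to a point kills `z` because `d ≠ 0`.
    rw [h, LinearMap.comp_apply, hkill c (Subsingleton.elim _ _), map_zero]

end RelHilali

end

/-! ### Quadratic growth of the homology kernel -/

noncomputable section

namespace RelHilali

variable {X Y : Type u} [TopologicalSpace X] [TopologicalSpace Y]

/-- The inclusion of `X × X` as the coordinates `i` and `j` of a power of `X`. -/
def pairIncl {ι : Type} [DecidableEq ι] (x : X) (i j : ι) : C(X × X, ι → X) :=
  ⟨fun p l => if l = i then p.1 else if l = j then p.2 else x, continuous_pi fun l => by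
    split_ifs <;> fun_prop⟩

/-- The projection of a power of `X` to the coordinates `i` and `j`. -/
def pairProj (X : Type u) [TopologicalSpace X] {ι : Type} (i j : ι) : C(ι → X, X × X) :=
  ⟨fun a => (a i, a j), by fun_prop⟩

lemma powMap_comp_pairIncl (f : C(X, Y)) {n : ℕ} (x : X) (i j : Fin n) :
    (powMap f n).comp (pairIncl x i j) = (pairIncl (f x) i j).comp (f.prodMap f) := by
  ext p l
  simp only [powMap, pairIncl, ContinuousMap.comp_apply, ContinuousMap.coe_mk,
    ContinuousMap.prodMap_apply, Prod.map_fst, Prod.map_snd]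
  split_ifs <;> rfl

/-- Cross products in different pairs of coordinates are linearly independent. -/
theorem sq_le_finrank_ker_powMap (f : C(X, Y)) (x : X) {d : ℕ} (hd : d ≠ 0)
    (hf : LinearMap.ker (ratHomologyMap d f) ≠ ⊥) {m n : ℕ} (hn : m + m ≤ n)
    [FiniteDimensional ℚ (LinearMap.ker (ratHomologyMap (d + d) (powMap f n)))] :
    m * m ≤ Module.finrank ℚ (LinearMap.ker (ratHomologyMap (d + d) (powMap f n))) := by
  obtain ⟨z, hz, hz0⟩ := (Submodule.ne_bot_iff _).1 hf
  obtain ⟨w, hw0, hwf, hw1, hw2⟩ := exists_cross_class f hd hz0 hz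
  -- Two disjoint blocks of `m` coordinates ensure that no pair has equal or interchanged entries.
  let α (i : Fin m) : Fin n := Fin.castLE hn (Fin.castAdd m i)
  let β (i : Fin m) : Fin n := Fin.castLE hn (Fin.natAdd m i)
  have hα : ∀ i j, α i = α j ↔ i = j := fun i j => by simp [α, Fin.ext_iff]
  have hβ : ∀ i j, β i = β j ↔ i = j := fun i j => by simp [β, Fin.ext_iff]
  have hαβ : ∀ i j, α i ≠ β j := fun i j => by
    have := i.2
    simp [α, β, Fin.ext_iff]
    omega
  have hmem : ∀ p : Fin m × Fin m, ratHomologyMap (d + d) (pairIncl x (α p.1) (β p.2)) w ∈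
      LinearMap.ker (ratHomologyMap (d + d) (powMap f n)) := fun p => by
    rw [LinearMap.mem_ker, ← LinearMap.comp_apply, ← ratHomologyMap_comp, powMap_comp_pairIncl,
      ratHomologyMap_comp, LinearMap.comp_apply, hwf, map_zero]
  have hproj : ∀ p q : Fin m × Fin m, ratHomologyMap (d + d) (pairProj X (α p.1) (β p.2))
      (ratHomologyMap (d + d) (pairIncl x (α q.1) (β q.2)) w) = if p = q then w else 0 := by
    intro p q
    rw [← LinearMap.comp_apply, ← ratHomologyMap_comp]
    split_ifs with h
    · subst h
      have : (pairProj X (α p.1) (β p.2)).comp (pairIncl x (α p.1) (β p.2)) =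
          ContinuousMap.id _ := by
        ext a <;> simp [pairProj, pairIncl, (hαβ _ _).symm]
      rw [this, ratHomologyMap_id, LinearMap.id_apply]
    -- If the pairs differ, at most one coordinate survives, so the composite `X × X → X × X`
    -- factors through a projection, and this kills `w`.
    · by_cases h1 : p.1 = q.1
      · have h2 : p.2 ≠ q.2 := fun h2 => h (Prod.ext h1 h2)
        have : (pairProj X (α p.1) (β p.2)).comp (pairIncl x (α q.1) (β q.2)) =
            (⟨fun a => (a, x), by fun_prop⟩ : C(X, X × X)).comp ContinuousMap.fst := by
          ext a <;> simp [pairProj, pairIncl, h1, h2, hβ, (hαβ _ _).symm]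
        rw [this, ratHomologyMap_comp, LinearMap.comp_apply, hw1, map_zero]
      · have : (pairProj X (α p.1) (β p.2)).comp (pairIncl x (α q.1) (β q.2)) =
            (⟨fun a => (x, if p.2 = q.2 then a else x), by split_ifs <;> fun_prop⟩ :
              C(X, X × X)).comp ContinuousMap.snd := by
          ext a <;> simp [pairProj, pairIncl, h1, hα, hβ, hαβ, (hαβ _ _).symm]
        rw [this, ratHomologyMap_comp, LinearMap.comp_apply, hw2, map_zero]
  have hli : LinearIndependent ℚ (fun p => (⟨_, hmem p⟩ :
      LinearMap.ker (ratHomologyMap (d + d) (powMap f n)))) := by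
    rw [Fintype.linearIndependent_iff]
    intro c hc p
    have h := congrArg (fun y => ratHomologyMap (d + d) (pairProj X (α p.1) (β p.2))
      (Subtype.val y)) hc
    simp only [Submodule.coe_sum, Submodule.coe_smul, map_sum, map_smul, hproj,
      Submodule.coe_zero, map_zero, smul_ite, smul_zero, Finset.sum_ite_eq, Finset.mem_univ,
      if_true] at h
    exact (smul_eq_zero.1 h).resolve_right hw0
  simpa using hli.fintype_card_le_finrank

end RelHilali

end

/-! ### Rational homotopy of powers and evaluation of the polynomials -/

noncomputable section

lemma LinearMap.nonempty_ker_equiv_pi {R V W V' W' ι : Type*} [Ring R] [AddCommGroup V]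
    [AddCommGroup W] [AddCommGroup V'] [AddCommGroup W'] [Module R V] [Module R W] [Module R V']
    [Module R W'] (A : V →ₗ[R] W) (B : V' →ₗ[R] W') (e : V' ≃ₗ[R] (ι → V))
    (e' : W' ≃ₗ[R] (ι → W)) (h : ∀ v i, e' (B v) i = A (e v i)) :
    Nonempty (LinearMap.ker B ≃ₗ[R] (ι → LinearMap.ker A)) := by
  have hmem : ∀ v, v ∈ LinearMap.ker B ↔ ∀ i, e v i ∈ LinearMap.ker A := fun v => by
    simp only [LinearMap.mem_ker, ← h]
    rw [← e'.map_eq_zero_iff, funext_iff]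
    rfl
  refine ⟨LinearEquiv.ofBijective (LinearMap.pi fun i =>
    ((LinearMap.proj i ∘ₗ e.toLinearMap) ∘ₗ (LinearMap.ker B).subtype).codRestrict _
      fun v => (hmem v.1).1 v.2 i) ⟨fun v v' hv => ?_, fun a => ?_⟩⟩
  · exact Subtype.ext (e.injective (funext fun i => congrArg Subtype.val (congrFun hv i)))
  · exact ⟨⟨e.symm fun i => (a i).1, (hmem _).2 fun i => by simp⟩, funext fun i =>
      Subtype.ext (congrFun (e.apply_symm_apply fun i => (a i).1) i)⟩

namespace RelHilali

variable {X Y Z : Type u} [TopologicalSpace X] [TopologicalSpace Y] [TopologicalSpace Z]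

/-- The homotopy groups of a power. -/
def piPowHom (k n : ℕ) (x : X) :
    π_ (k + 2) (Fin n → X) (fun _ => x) →* (Fin n → π_ (k + 2) X x) :=
  MonoidHom.pi fun i => piHom k (⟨fun a => a i, by fun_prop⟩ : C(Fin n → X, X)) fun _ => x

/-- Loops and homotopies into a power are assembled coordinatewise. -/
lemma piPowHom_bijective (k n : ℕ) (x : X) : Function.Bijective (piPowHom k n x) := by
  constructor
  · rintro ⟨p⟩ ⟨q⟩ h
    have h' (i : Fin n) : GenLoop.Homotopic (genLoopMap _ _ p) (genLoopMap _ _ q) :=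
      Quotient.exact (congrFun h i)
    exact Quotient.sound ⟨ContinuousMap.HomotopyRel.pi fun i => (h' i).some⟩
  · intro a
    choose p hp using fun i => Quotient.exists_rep (a i)
    refine ⟨Quotient.mk _ ⟨ContinuousMap.pi fun i => (p i).1, fun y hy =>
      funext fun i => (p i).2 y hy⟩, funext fun i => Eq.trans ?_ (hp i)⟩
    rfl

lemma piPowHom_powMap (k n : ℕ) (f : C(X, Y)) (x : X) (a : π_ (k + 2) (Fin n → X) fun _ => x)
    (i : Fin n) : piPowHom k n (f x) (piHom k (powMap f n) (fun _ => x) a) i =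
      piHom k f x (piPowHom k n x a i) := by
  obtain ⟨p⟩ := a
  rfl

/-- The rational homotopy groups of a power. -/
def ratPiPowEquiv (k n : ℕ) (x : X) :
    ℚ ⊗[ℤ] Additive (π_ (k + 2) (Fin n → X) fun _ => x) ≃ₗ[ℚ]
      (Fin n → ℚ ⊗[ℤ] Additive (π_ (k + 2) X x)) :=
  LinearEquiv.baseChange ℤ ℚ _ _ (AddEquiv.toIntLinearEquiv
    (M₂ := Fin n → Additive (π_ (k + 2) X x))
    (MulEquiv.toAdditive (MulEquiv.ofBijective _ (piPowHom_bijective k n x)))) ≪≫ₗ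
    TensorProduct.piRight ℤ ℚ ℚ _

lemma ratPiPowEquiv_ratPiMap (k n : ℕ) (f : C(X, Y)) (x : X)
    (v : ℚ ⊗[ℤ] Additive (π_ (k + 2) (Fin n → X) fun _ => x)) (i : Fin n) :
    ratPiPowEquiv k n (f x) (ratPiMap k (powMap f n) (fun _ => x) v) i =
      ratPiMap k f x (ratPiPowEquiv k n x v i) := by
  induction v with
  | zero =>
    simp only [map_zero, Pi.zero_apply]
    exact congrFun (map_zero (ratPiPowEquiv k n (f x))) i
  | add v w hv hw =>
    simp only [map_add, Pi.add_apply]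
    exact (congrFun (map_add (ratPiPowEquiv k n (f x)) _ _) i).trans (congrArg₂ (· + ·) hv hw)
  | tmul r a => exact congrArg (r ⊗ₜ[ℤ] ·) (piPowHom_powMap k n f x a i)

lemma nonempty_ker_ratPiMap_powMap (k n : ℕ) (f : C(X, Y)) (x : X) :
    Nonempty (LinearMap.ker (ratPiMap k (powMap f n) fun _ => x) ≃ₗ[ℚ]
      (Fin n → LinearMap.ker (ratPiMap k f x))) :=
  LinearMap.nonempty_ker_equiv_pi _ _ (ratPiPowEquiv k n x) (ratPiPowEquiv k n (f x))
    (ratPiPowEquiv_ratPiMap k n f x)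

lemma finrank_ker_ratPiMap_powMap (k n : ℕ) (f : C(X, Y)) (x : X)
    [FiniteDimensional ℚ (LinearMap.ker (ratPiMap k f x))] :
    Module.finrank ℚ (LinearMap.ker (ratPiMap k (powMap f n) fun _ => x)) =
      n * Module.finrank ℚ (LinearMap.ker (ratPiMap k f x)) := by
  obtain ⟨e⟩ := nonempty_ker_ratPiMap_powMap k n f x
  rw [e.finrank_eq, Module.finrank_pi_fintype]
  simp

/-- The homological half follows from the finite homology of `X^n`, which contains the kernels; the
homotopical half from the kernel being `n` copies of that of `f`. -/
theorem IsRatEllipticKer.powMap {f : C(X, Y)} {x : X} (hf : IsRatEllipticKer f x)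
    (hX : HasFiniteHomologyRank X) (n : ℕ) :
    IsRatEllipticKer (powMap f n) fun _ => x where
  finite_homology i := by
    have := (hX.pi n).1 i
    infer_instance
  bounded_homology := (hX.pi n).2.subset fun i hi => by
    obtain ⟨z, -, hz⟩ := (Submodule.ne_bot_iff _).1 hi
    exact ⟨z, 0, hz⟩
  finite_homotopy k := by
    have := hf.finite_homotopy k
    obtain ⟨e⟩ := nonempty_ker_ratPiMap_powMap k n f x
    exact e.symm.finiteDimensional
  bounded_homotopy := hf.bounded_homotopy.subset fun k hk h => by
    obtain ⟨e⟩ := nonempty_ker_ratPiMap_powMap k n f x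
    have : Subsingleton (LinearMap.ker (ratPiMap k f x)) :=
      (Submodule.subsingleton_iff_eq_bot).2 h
    exact hk ((Submodule.subsingleton_iff_eq_bot).1 e.toEquiv.subsingleton)

lemma eval_finsum_monomial {a : ℕ → ℕ} (ha : {k | a k ≠ 0}.Finite) (s : ℝ) :
    (∑ᶠ k : ℕ, Polynomial.monomial (k + 2) (a k : ℝ)).eval s = ∑ᶠ k : ℕ, (a k : ℝ) * s ^ (k + 2) := by
  have h : (Function.support fun k : ℕ => Polynomial.monomial (k + 2) (a k : ℝ)).Finite :=
    ha.subset fun k hk hk' => hk (by simp [hk'])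
  have h2 := (Polynomial.evalRingHom s).toAddMonoidHom.map_finsum h
  simpa using h2

lemma finite_finrank_ne_zero {V : ℕ → Type*} [∀ k, AddCommGroup (V k)] [∀ k, Module ℚ (V k)]
    {A : ∀ k, Submodule ℚ (V k)} (h : {k | A k ≠ ⊥}.Finite) :
    {k | Module.finrank ℚ (A k) ≠ 0}.Finite :=
  h.subset fun k hk hk' => hk (by rw [hk', finrank_bot])

lemma IsRatEllipticKer.eval_piPoly {f : C(X, Y)} {x : X} (hf : IsRatEllipticKer f x) (s : ℝ) :
    (piPoly f x).eval s =
      ∑ᶠ k : ℕ, (Module.finrank ℚ (LinearMap.ker (ratPiMap k f x)) : ℝ) * s ^ (k + 2) :=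
  eval_finsum_monomial (finite_finrank_ne_zero hf.bounded_homotopy) s

lemma IsRatEllipticKer.finite_homology_support {f : C(X, Y)} {x : X} (hf : IsRatEllipticKer f x) :
    {k | Module.finrank ℚ (LinearMap.ker (ratHomologyMap (k + 2) f)) ≠ 0}.Finite :=
  finite_finrank_ne_zero (hf.bounded_homology.preimage (add_left_injective 2).injOn)

lemma IsRatEllipticKer.eval_homPoly {f : C(X, Y)} {x : X} (hf : IsRatEllipticKer f x) (s : ℝ) :
    (homPoly f).eval s = 1 +
      ∑ᶠ k : ℕ, (Module.finrank ℚ (LinearMap.ker (ratHomologyMap (k + 2) f)) : ℝ) * s ^ (k + 2) := by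
  rw [homPoly, Polynomial.eval_add, Polynomial.eval_one,
    eval_finsum_monomial hf.finite_homology_support s]

/-- For `s ≥ 0` all terms are nonnegative, so one degree already bounds the polynomial from below.
-/
lemma IsRatEllipticKer.le_eval_homPoly {f : C(X, Y)} {x : X} (hf : IsRatEllipticKer f x) {s : ℝ}
    (hs : 0 ≤ s) (k : ℕ) :
    1 + (Module.finrank ℚ (LinearMap.ker (ratHomologyMap (k + 2) f)) : ℝ) * s ^ (k + 2) ≤
      (homPoly f).eval s := by
  rw [hf.eval_homPoly]
  gcongr
  refine single_le_finsum (f := fun k => (Module.finrank ℚ (LinearMap.ker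
    (ratHomologyMap (k + 2) f)) : ℝ) * s ^ (k + 2)) k
    (hf.finite_homology_support.subset fun k hk hk' => hk (by simp [hk'])) fun k => by positivity

lemma IsRatEllipticKer.eval_piPoly_powMap {f : C(X, Y)} {x : X} (hf : IsRatEllipticKer f x)
    (hX : HasFiniteHomologyRank X) (n : ℕ) (s : ℝ) :
    (piPoly (RelHilali.powMap f n) fun _ => x).eval s = n * (piPoly f x).eval s := by
  rw [(hf.powMap hX n).eval_piPoly, hf.eval_piPoly, mul_finsum]
  refine finsum_congr fun k => ?_
  have := hf.finite_homotopy k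
  rw [finrank_ker_ratPiMap_powMap]
  push_cast
  ring

end RelHilali

end

theorem mainTheorem4 {X Y : Type u} [TopologicalSpace X] [TopologicalSpace Y]
    [SimplyConnectedSpace X] [SimplyConnectedSpace Y] (f : C(X, Y)) (x : X)
    (hf : RelHilali.IsRatEllipticKer f x) (hX : RelHilali.HasFiniteHomologyRank X)
    (hP : 1 < (RelHilali.homPoly f).eval 1) :
    (∀ n : ℕ, RelHilali.IsRatEllipticKer (RelHilali.powMap f n) (fun _ => x)) ∧
      ∀ s : ℝ, 0 ≤ s → ∃ N : ℕ, 0 < N ∧ ∀ n : ℕ, N ≤ n →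
        (RelHilali.piPoly (RelHilali.powMap f n) (fun _ => x)).eval s <
          (RelHilali.homPoly (RelHilali.powMap f n)).eval s := by
  refine ⟨hf.powMap hX, fun s hs => ?_⟩
  -- If all kernels in degrees at least `2` vanished, `P_f(1)` would equal `1`.
  obtain ⟨k, hk⟩ : ∃ k, LinearMap.ker (RelHilali.ratHomologyMap (k + 2) f) ≠ ⊥ := by
    by_contra! h
    have h' k : Module.finrank ℚ (LinearMap.ker (RelHilali.ratHomologyMap (k + 2) f)) = 0 := by
      rw [h k, finrank_bot]
    rw [hf.eval_homPoly] at hP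
    simp [h'] at hP
  have key : ∀ m n : ℕ, m + m ≤ n →
      1 + (m * m : ℝ) * s ^ (k + k + 4) ≤ (RelHilali.homPoly (RelHilali.powMap f n)).eval s := by
    intro m n hmn
    have hn := hf.powMap hX n
    have := hn.finite_homology (k + 2 + (k + 2))
    have h1 := RelHilali.sq_le_finrank_ker_powMap f x (by omega) hk hmn
    -- With `d = k + 2`, the degree `2d` has index `k + 2 + k`, since indices are shifted by `2`.
    have h2 := hn.le_eval_homPoly hs (k + 2 + k)
    refine le_trans ?_ h2
    rw [show k + k + 4 = k + 2 + k + 2 by ring]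
    gcongr
    exact_mod_cast h1
  set c := (RelHilali.piPoly f x).eval s with hc
  -- At `s = 0` the quadratic term vanishes, but `P^π` has no constant term.
  rcases hs.eq_or_lt with rfl | hs'
  · refine ⟨1, one_pos, fun n _ => ?_⟩
    have hc0 : c = 0 := by
      rw [hc, hf.eval_piPoly]
      simp
    rw [hf.eval_piPoly_powMap hX, ← hc, hc0, mul_zero]
    have := key 0 n (by omega)
    simp at this
    linarith
  · obtain ⟨M, hM⟩ := exists_nat_gt (3 * |c| / s ^ (k + k + 4))
    rw [div_lt_iff₀ (by positivity)] at hM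
    -- With `m = ⌊n/2⌋`, this gives `m ≥ M`, and `n ≥ 2` gives `n ≤ 3m`; hence the factor `3` in the
    -- choice of `M`.
    refine ⟨2 * M + 2, by omega, fun n hn => ?_⟩
    rw [hf.eval_piPoly_powMap hX, ← hc]
    refine lt_of_lt_of_le ?_ (key (n / 2) n (by omega))
    have h1 : M ≤ n / 2 := by omega
    have h2 : n ≤ 3 * (n / 2) := by omega
    generalize n / 2 = m at h1 h2
    have h3 : (n : ℝ) ≤ 3 * m := by exact_mod_cast h2
    calc n * c ≤ n * |c| := by gcongr; exact le_abs_self c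
      _ ≤ 3 * m * |c| := by gcongr
      _ = m * (3 * |c|) := by ring
      _ ≤ m * (M * s ^ (k + k + 4)) := by gcongr
      _ ≤ m * (m * s ^ (k + k + 4)) := by gcongr
      _ = m * m * s ^ (k + k + 4) := by ring
      _ < _ := lt_one_add _
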